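/- \textbf{Model.} Let $T\in\mathbb N$. Latent skills $\theta_t>0$ ($t=0,\dots,T$), latent investment $I_t>0$ and observed income $Y_t>0$ ($t=0,\dots,T-1$), skill measures $Z_{\theta,t,m}$, investment measures $Z_{I,t,m}$ ($m=1,2$) and an adult outcome $Q$ satisfy, almost surely, \begin{align*} \ln\theta_{t+1}&=a_t+\gamma_{1t}\ln\theta_t+\gamma_{2t}\ln I_t+\gamma_{3t}\ln\theta_t\ln I_t+\eta_{\theta,t} && t=0,\dots,T-1,\\ Z_{\theta,t,m}&=\mu_{\theta,t,m}+\lambda_{\theta,t,m}\ln\theta_t+\varepsilon_{\theta,t,m} && t=0,\dots,T,\\ Z_{I,t,m}&=\mu_{I,t,m}+\lambda_{I,t,m}\ln I_t+\varepsilon_{I,t,m} && t=0,\dots,T-1,\\ \ln I_t&=\beta_{0t}+\beta_{1t}\ln\theta_t+\beta_{2t}\ln Y_t+\eta_{I,t} && t=0,\dots,T-1,\\ Q&=\rho_0+\rho_1\ln\theta_T+\eta_Q . \end{align*} Write $Y=(Y_0,\dots,Y_{T-1})$. The \emph{baseline assumption} is that income affects investment, $\beta_{2t}\ne0$ for all $t$,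 and that: \begin{enumerate} \item[(a)] conditionally on $Y$, the errors $\varepsilon_{\theta,t,m}$, $\varepsilon_{I,t,m}$, $\eta_Q$ (all $t,m$) are jointly independent and independent of $(\{\theta_t\}_{t=0}^{T},\{I_t\}_{t=0}^{T-1})$; \item[(b)] $\ln\theta_t,\ln I_t,\ln Y_t$, all errors and all shocks $\eta_{\theta,t},\eta_{I,t}$ have finite second moments; \item[(c)] $E[\varepsilon_{\theta,t,m}\mid Y]=E[\varepsilon_{I,t,m}\mid Y]=E[\eta_Q\mid Y]=0$; \item[(d)] $\lambda_{\theta,t,m}\neq0$ and $\lambda_{I,t,m}\ne0$ for all $t,m$; \item[(e)] each $\ln\theta_t$ has nonzero covariance with some $\ln I_s$ or some $\ln\theta_s$, $s\neq t$; each $\ln I_t$ has nonzero covariance with some $\ln\theta_s$ or some $\ln I_s$, $s\ne t$; \item[(f)] for each of the errors $\varepsilon_{\theta,t,m},\varepsilon_{I,t,m},\eta_Q$ and almost every value of $Y$, the real zeros of its conditional characteristic function given $Y$ are isolated and are not zeros of the derivative; \item[(g)] for $t=0,\dots,T-1$ the support of $(\theta_t,I_t,Y_t)$ includes an open ball of $\mathbb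 R^3$; \item[(h)] for $t=0,\dots,T-1$, $E[\eta_{\theta,t}\mid\theta_t,Y_t]=E[\eta_{I,t}\mid\theta_t,Y_t]=0$ and $E[\eta_{\theta,t}\mid\theta_t,\eta_{I,t},Y_t]=\kappa_t\eta_{I,t}$ for some $\kappa_t\in\mathbb R$. \end{enumerate} The primitive parameter vector $p$ consists of all $\mu_{\theta,t,m},\lambda_{\theta,t,m},\mu_{I,t,m},\lambda_{I,t,m},\rho_0,\rho_1,\beta_{0t},\beta_{1t},\beta_{2t},a_t,\gamma_{1t},\gamma_{2t},\gamma_{3t}$. Given the true parameter vector, for which the model holds under the baseline assumption, its \emph{identified set} is the set of all $p$ for which there are a (standard Borel) probability space and random variables on it that satisfy the model with parameters $p$ and the baseline assumption and generate the true joint distribution of the observed variables $(\{Z_{\theta,t,m}\},\{Z_{I,t,m}\},\{Y_t\},Q)$. \textbf{Rescaled parameters.} For $p$ with nonzero loadings let $\tilde p$ consist of \begin{align*} &\tilde\lambda_{\theta,t,m}=\tfrac{\lambda_{\theta,t,m}}{\lambda_{\theta,t,1}},\quad \tilde\mu_{\theta,t,m}=\mu_{\theta,t,m}-\tfrac{\lambda_{\theta,t,m}}{\lambda_{\theta,t,1}}\mu_{\theta,t,1},\quad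 \tilde\lambda_{I,t,m}=\tfrac{\lambda_{I,t,m}}{\lambda_{I,t,1}},\quad \tilde\mu_{I,t,m}=\mu_{I,t,m}-\tfrac{\lambda_{I,t,m}}{\lambda_{I,t,1}}\mu_{I,t,1},\\ &\tilde\rho_0=\rho_0-\tfrac{\rho_1\mu_{\theta,T,1}}{\lambda_{\theta,T,1}},\quad \tilde\rho_1=\tfrac{\rho_1}{\lambda_{\theta,T,1}},\\ &\tilde\beta_{0t}=\lambda_{I,t,1}\beta_{0t}+\mu_{I,t,1}-\tfrac{\lambda_{I,t,1}}{\lambda_{\theta,t,1}}\mu_{\theta,t,1}\beta_{1t},\quad \tilde\beta_{1t}=\tfrac{\lambda_{I,t,1}}{\lambda_{\theta,t,1}}\beta_{1t},\quad \tilde\beta_{2t}=\lambda_{I,t,1}\beta_{2t},\\ &\tilde a_t=\lambda_{\theta,t+1,1}a_t+\mu_{\theta,t+1,1}-\tfrac{\lambda_{\theta,t+1,1}}{\lambda_{\theta,t,1}}\mu_{\theta,t,1}\gamma_{1t}-\tfrac{\lambda_{\theta,t+1,1}}{\lambda_{I,t,1}}\mu_{I,t,1}\gamma_{2t}+\tfrac{\lambda_{\theta,t+1,1}}{\lambda_{\theta,t,1}\lambda_{I,t,1}}\mu_{I,t,1}\mu_{\theta,t,1}\gamma_{3t},\\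 &\tilde\gamma_{1t}=\tfrac{\lambda_{\theta,t+1,1}}{\lambda_{\theta,t,1}}\Bigl(\gamma_{1t}-\tfrac{\mu_{I,t,1}}{\lambda_{I,t,1}}\gamma_{3t}\Bigr),\quad \tilde\gamma_{2t}=\tfrac{\lambda_{\theta,t+1,1}}{\lambda_{I,t,1}}\Bigl(\gamma_{2t}-\tfrac{\mu_{\theta,t,1}}{\lambda_{\theta,t,1}}\gamma_{3t}\Bigr),\quad \tilde\gamma_{3t}=\tfrac{\lambda_{\theta,t+1,1}}{\lambda_{\theta,t,1}\lambda_{I,t,1}}\gamma_{3t}. \end{align*} \textbf{Theorem.} Suppose the model holds under the baseline assumption with true parameter vector $p_0$. \begin{enumerate} \item The identified set is the set of all parameter vectors $p$ with nonzero loadings such that $\tilde p=\tilde p_0$. \item Let $\bar\mu_{\theta,t}$, $\bar\lambda_{\theta,t}\neq0$ ($t=0,\dots,T$) and $\bar\mu_{I,t}$, $\bar\lambda_{I,t}\ne0$ ($t=0,\dots,T-1$) be arbitrary constants. The set of those $p$ in the identified set with $\mu_{\theta,t,1}=\bar\mu_{\theta,t}$, $\lambda_{\theta,t,1}=\bar\lambda_{\theta,t}$,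 $\mu_{I,t,1}=\bar\mu_{I,t}$ and $\lambda_{I,t,1}=\bar\lambda_{I,t}$ for all $t$ is a singleton. \end{enumerate} -/

import Mathlib

open MeasureTheory ProbabilityTheory Filter Topology

noncomputable section

namespace SkillFormation

/-- The finite-dimensional primitive parameters of the trans-log skill formation model with periods
`0, …, T`. The suffix `S` refers to skills and `I` to investment; the index `0 : Fin 2` is the first
measure and `1 : Fin 2` the second. -/
@[ext]
structure Params (T : ℕ) where
  /-- intercepts of the skill measures -/
  muS : Fin (T + 1) → Fin 2 → ℝ
  /-- loadings of the skill measures -/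
  lamS : Fin (T + 1) → Fin 2 → ℝ
  /-- intercepts of the investment measures -/
  muI : Fin T → Fin 2 → ℝ
  /-- loadings of the investment measures -/
  lamI : Fin T → Fin 2 → ℝ
  /-- intercept of the adult outcome equation -/
  rho0 : ℝ
  /-- slope of the adult outcome equation -/
  rho1 : ℝ
  /-- intercept of the investment equation -/
  beta0 : Fin T → ℝ
  /-- coefficient of log skills in the investment equation -/
  beta1 : Fin T → ℝ
  /-- coefficient of log income in the investment equation -/
  beta2 : Fin T → ℝ
  /-- intercept of the production function -/
  a : Fin T → ℝ
  /-- coefficient of log skills in the production function -/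
  gam1 : Fin T → ℝ
  /-- coefficient of log investment in the production function -/
  gam2 : Fin T → ℝ
  /-- coefficient of the interaction in the production function -/
  gam3 : Fin T → ℝ

/-- All loadings of the measurement system are nonzero. -/
def Params.NonzeroLoadings {T : ℕ} (p : Params T) : Prop :=
  (∀ t m, p.lamS t m ≠ 0) ∧ (∀ t m, p.lamI t m ≠ 0)

/-- The rescaled ("tilde") parameters, i.e. the parameters of the model written in terms of
`μ_{θ,t,1} + λ_{θ,t,1} ln θ_t` and `μ_{I,t,1} + λ_{I,t,1} ln I_t`. -/
def Params.tilde {T : ℕ} (p : Params T) : Params T where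
  muS t m := p.muS t m - p.lamS t m / p.lamS t 0 * p.muS t 0
  lamS t m := p.lamS t m / p.lamS t 0
  muI t m := p.muI t m - p.lamI t m / p.lamI t 0 * p.muI t 0
  lamI t m := p.lamI t m / p.lamI t 0
  rho0 := p.rho0 - p.rho1 * p.muS (Fin.last T) 0 / p.lamS (Fin.last T) 0
  rho1 := p.rho1 / p.lamS (Fin.last T) 0
  beta0 t := p.lamI t 0 * p.beta0 t + p.muI t 0
    - p.lamI t 0 / p.lamS t.castSucc 0 * p.muS t.castSucc 0 * p.beta1 t
  beta1 t := p.lamI t 0 / p.lamS t.castSucc 0 * p.beta1 t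
  beta2 t := p.lamI t 0 * p.beta2 t
  a t := p.lamS t.succ 0 * p.a t + p.muS t.succ 0
    - p.lamS t.succ 0 / p.lamS t.castSucc 0 * p.muS t.castSucc 0 * p.gam1 t
    - p.lamS t.succ 0 / p.lamI t 0 * p.muI t 0 * p.gam2 t
    + p.lamS t.succ 0 / (p.lamS t.castSucc 0 * p.lamI t 0)
        * p.muI t 0 * p.muS t.castSucc 0 * p.gam3 t
  gam1 t := p.lamS t.succ 0 / p.lamS t.castSucc 0
    * (p.gam1 t - p.muI t 0 / p.lamI t 0 * p.gam3 t)
  gam2 t := p.lamS t.succ 0 / p.lamI t 0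
    * (p.gam2 t - p.muS t.castSucc 0 / p.lamS t.castSucc 0 * p.gam3 t)
  gam3 t := p.lamS t.succ 0 / (p.lamS t.castSucc 0 * p.lamI t 0) * p.gam3 t

/-- Index set of the errors of the measurement system: the errors of the skill measures, the errors
of the investment measures, and the error of the adult outcome. -/
abbrev ErrIdx (T : ℕ) : Type := (Fin (T + 1) × Fin 2) ⊕ (Fin T × Fin 2) ⊕ Unit

/-- The random variables that drive the model, on a sample space `Ω`: skills, investment, income,
the errors of the measurement system and the shocks of the production and investment equations. -/
structure Primitives (T : ℕ) (Ω : Type) where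
  /-- skills `θ_t` -/
  skill : Fin (T + 1) → Ω → ℝ
  /-- investment `I_t` -/
  inv : Fin T → Ω → ℝ
  /-- parental income `Y_t` -/
  inc : Fin T → Ω → ℝ
  /-- measurement errors and the error of the adult outcome -/
  err : ErrIdx T → Ω → ℝ
  /-- production shocks -/
  etaS : Fin T → Ω → ℝ
  /-- investment shocks -/
  etaI : Fin T → Ω → ℝ

namespace Primitives

variable {T : ℕ} {Ω : Type}

/-- log skills -/
def logSkill (L : Primitives T Ω) (t : Fin (T + 1)) (ω : Ω) : ℝ := Real.log (L.skill t ω)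

/-- log investment -/
def logInv (L : Primitives T Ω) (t : Fin T) (ω : Ω) : ℝ := Real.log (L.inv t ω)

/-- log income -/
def logInc (L : Primitives T Ω) (t : Fin T) (ω : Ω) : ℝ := Real.log (L.inc t ω)

/-- The vector of incomes of all periods. -/
def incVec (L : Primitives T Ω) (ω : Ω) : Fin T → ℝ := fun t => L.inc t ω

/-- The vector of all latent skills and investments. -/
def latentVec (L : Primitives T Ω) (ω : Ω) : (Fin (T + 1) → ℝ) × (Fin T → ℝ) :=
  (fun t => L.skill t ω, fun t => L.inv t ω)

/-- The vector of all errors of the measurement system. -/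
def errVec (L : Primitives T Ω) (ω : Ω) : ErrIdx T → ℝ := fun i => L.err i ω

/-- The skill measures. -/
def ZS (L : Primitives T Ω) (p : Params T) (t : Fin (T + 1)) (m : Fin 2) (ω : Ω) : ℝ :=
  p.muS t m + p.lamS t m * L.logSkill t ω + L.err (Sum.inl (t, m)) ω

/-- The investment measures. -/
def ZI (L : Primitives T Ω) (p : Params T) (t : Fin T) (m : Fin 2) (ω : Ω) : ℝ :=
  p.muI t m + p.lamI t m * L.logInv t ω + L.err (Sum.inr (Sum.inl (t, m))) ω

/-- The adult outcome. -/
def Q (L : Primitives T Ω) (p : Params T) (ω : Ω) : ℝ :=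
  p.rho0 + p.rho1 * L.logSkill (Fin.last T) ω + L.err (Sum.inr (Sum.inr ())) ω

end Primitives

/-- The space of values of the observed variables: skill measures, investment measures, income and
adult outcome. -/
abbrev Obs (T : ℕ) : Type :=
  (Fin (T + 1) → Fin 2 → ℝ) × (Fin T → Fin 2 → ℝ) × (Fin T → ℝ) × ℝ

/-- The joint distribution of the observed variables generated by the model. -/
def obsLaw {T : ℕ} {Ω : Type} [MeasurableSpace Ω] (P : Measure Ω) (L : Primitives T Ω)
    (p : Params T) : Measure (Obs T) :=
  P.map fun ω => (fun t m => L.ZS p t m ω, fun t m => L.ZI p t m ω, L.incVec ω, L.Q p ω)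

/-- The zeros of `φ` are isolated and are not zeros of its derivative. -/
def RegularZeros (φ : ℝ → ℂ) : Prop :=
  ∀ s, φ s = 0 → (∀ᶠ u in 𝓝[≠] s, φ u ≠ 0) ∧ deriv φ s ≠ 0

/-- The trans-log model with parameters `p` and random variables `L` under the baseline
assumption. -/
structure Baseline {T : ℕ} {Ω : Type} [MeasurableSpace Ω] [StandardBorelSpace Ω] (P : Measure Ω)
    [IsProbabilityMeasure P] (L : Primitives T Ω) (p : Params T) : Prop where
  meas_skill : ∀ t, Measurable (L.skill t)
  meas_inv : ∀ t, Measurable (L.inv t)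
  meas_incVec : Measurable L.incVec
  meas_err : ∀ i, Measurable (L.err i)
  meas_etaS : ∀ t, Measurable (L.etaS t)
  meas_etaI : ∀ t, Measurable (L.etaI t)
  /-- skills, investment and income are positive, so that their logarithms are meaningful -/
  pos_skill : ∀ t, ∀ᵐ ω ∂P, 0 < L.skill t ω
  pos_inv : ∀ t, ∀ᵐ ω ∂P, 0 < L.inv t ω
  pos_inc : ∀ t, ∀ᵐ ω ∂P, 0 < L.inc t ω
  /-- the trans-log production function -/
  production : ∀ t : Fin T, ∀ᵐ ω ∂P, L.logSkill t.succ ω =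
    p.a t + p.gam1 t * L.logSkill t.castSucc ω + p.gam2 t * L.logInv t ω
      + p.gam3 t * L.logSkill t.castSucc ω * L.logInv t ω + L.etaS t ω
  /-- the investment equation -/
  investment : ∀ t : Fin T, ∀ᵐ ω ∂P, L.logInv t ω =
    p.beta0 t + p.beta1 t * L.logSkill t.castSucc ω + p.beta2 t * L.logInc t ω + L.etaI t ω
  /-- income affects investment (relevance of the instrument) -/
  relevance : ∀ t : Fin T, p.beta2 t ≠ 0
  /-- (a) conditionally on the incomes, the errors are jointly independent … -/
  err_iIndep : iCondIndepFun (MeasurableSpace.comap L.incVec inferInstance) meas_incVec.comap_le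
    L.err P
  /-- … and independent of skills and investment -/
  err_indep_latent : CondIndepFun (MeasurableSpace.comap L.incVec inferInstance)
    meas_incVec.comap_le L.errVec L.latentVec P
  /-- (b) finite first and second moments of all variables in the (log-linear) equations -/
  moment_skill : ∀ t, MemLp (L.logSkill t) 2 P
  moment_inv : ∀ t, MemLp (L.logInv t) 2 P
  moment_inc : ∀ t, MemLp (L.logInc t) 2 P
  moment_err : ∀ i, MemLp (L.err i) 2 P
  moment_etaS : ∀ t, MemLp (L.etaS t) 2 P
  moment_etaI : ∀ t, MemLp (L.etaI t) 2 P
  /-- (c) the errors have mean zero, given the incomes -/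
  err_mean : ∀ i, P[L.err i | MeasurableSpace.comap L.incVec inferInstance] =ᵐ[P] 0
  /-- (d) the loadings are nonzero -/
  loadings : p.NonzeroLoadings
  /-- (e) every latent variable is correlated with another one -/
  cov_skill : ∀ t : Fin (T + 1),
    (∃ s : Fin T, cov[L.logSkill t, L.logInv s; P] ≠ 0) ∨
    (∃ s : Fin (T + 1), s ≠ t ∧ cov[L.logSkill t, L.logSkill s; P] ≠ 0)
  cov_inv : ∀ t : Fin T,
    (∃ s : Fin (T + 1), cov[L.logInv t, L.logSkill s; P] ≠ 0) ∨
    (∃ s : Fin T, s ≠ t ∧ cov[L.logInv t, L.logInv s; P] ≠ 0)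
  /-- (f) zeros of the characteristic functions of the errors, given the incomes -/
  err_charFun : ∀ i, ∀ᵐ y ∂(P.map L.incVec),
    RegularZeros (charFun (condDistrib (L.err i) L.incVec P y))
  /-- (g) the support of `(θ_t, I_t, Y_t)` includes an open ball -/
  support_ball : ∀ t : Fin T, ∃ (x : ℝ × ℝ × ℝ) (r : ℝ), 0 < r ∧ Metric.ball x r ⊆
    (P.map fun ω => (L.skill t.castSucc ω, L.inv t ω, L.inc t ω)).support
  /-- (h) the shocks have conditional mean zero given `(θ_t, Y_t)` … -/
  etaS_mean : ∀ t : Fin T, P[L.etaS t | MeasurableSpace.comap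
    (fun ω => (L.skill t.castSucc ω, L.inc t ω)) inferInstance] =ᵐ[P] 0
  etaI_mean : ∀ t : Fin T, P[L.etaI t | MeasurableSpace.comap
    (fun ω => (L.skill t.castSucc ω, L.inc t ω)) inferInstance] =ᵐ[P] 0
  /-- … and the control function condition holds for some `κ_t` -/
  control : ∀ t : Fin T, ∃ κ : ℝ, P[L.etaS t | MeasurableSpace.comap
    (fun ω => (L.skill t.castSucc ω, L.etaI t ω, L.inc t ω)) inferInstance]
      =ᵐ[P] fun ω => κ * L.etaI t ω

/-- The identified set of the primitive parameters, given the distribution `D` of the observed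
variables: all parameter vectors for which some random variables satisfy the model and the baseline
assumption and generate `D`. -/
def identifiedSet {T : ℕ} (D : Measure (Obs T)) : Set (Params T) :=
  {p | ∃ (Ω : Type) (_ : MeasurableSpace Ω) (_ : StandardBorelSpace Ω) (P : Measure Ω)
    (_ : IsProbabilityMeasure P) (L : Primitives T Ω), Baseline P L p ∧ obsLaw P L p = D}

end SkillFormation

end

noncomputable section

namespace SkillFormation

/-! Only the affine scales of log skills and log investment are free. Changing these scales and
adjusting the parameters preserves every clause of the baseline assumption and leaves the observed
variables pointwise unchanged (`Baseline.reparam`, `obsLaw_reparam`). The rescaled parameters are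
what such changes keep fixed, so every vector with nonzero loadings and the same rescaled parameters
is in the identified set. For the converse, two observationally equivalent models are moved to the
scales in which the first measures have intercept 0 and loading 1; it remains to show that
normalized parameters are determined by the observed law (`Baseline.params_eq`).

Covariances of measures of different latent variables contain no error terms. Comparing those of an
arbitrary measure and of the first measure of the same latent variable gives the loadings, and means
give the intercepts (`Baseline.measurement_eq`). The adult outcome counts as one more measure of
final skills.

Next, the joint law of latent variables and income is recovered, conditionally on income. A contrast
of two measurements removes the latent variable. Its characteristic function, and the same
expectation weighted by the first measurement, determine the products `φ₁ φ₂` and `φ₁' φ₂`, where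
`φ₁` belongs to the first error and `φ₂` to the rescaled second. A Wronskian argument that allows
for zeros then determines `φ₁` (`map_error_eq_of_map_measurements_eq`). With the first errors known,
the law of the latent vector follows by deconvolution (`map_latent_eq_of_map_measurements_eq`,
`MeasurementErrors.map_latent_eq`).

Finally, the difference of two candidate regression functions vanishes almost surely
(`ae_eq_zero_of_residuals`), and an open ball in the support forces its coefficients to vanish. This
settles the investment equation. In the production equation the investment residual serves as a
control function; log income enters only through it, so `β₂ ≠ 0` separates the control coefficient
from the technology (`Baseline.production_eq`). -/

/-! ### Functions with isolated zeros and the Wronskian argument -/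

/-- The zeros of `φ` are isolated. -/
def IsolatedZeros (φ : ℝ → ℂ) : Prop :=
  ∀ s, φ s = 0 → ∀ᶠ u in 𝓝[≠] s, φ u ≠ 0

lemma RegularZeros.isolatedZeros {φ : ℝ → ℂ} (h : RegularZeros φ) : IsolatedZeros φ :=
  fun s hs => (h s hs).1

lemma IsolatedZeros.eventually_ne {φ : ℝ → ℂ} (h : IsolatedZeros φ) (hc : Continuous φ) (s : ℝ) :
    ∀ᶠ u in 𝓝[≠] s, φ u ≠ 0 := by
  by_cases hs : φ s = 0
  · exact h s hs
  · exact (hc.continuousAt.eventually_ne hs).filter_mono nhdsWithin_le_nhds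

lemma IsolatedZeros.dense {φ : ℝ → ℂ} (h : IsolatedZeros φ) (hc : Continuous φ) :
    Dense {s | φ s ≠ 0} := fun s =>
  mem_closure_iff_frequently.2 ((h.eventually_ne hc s).frequently.filter_mono nhdsWithin_le_nhds)

lemma IsolatedZeros.comp_mul {φ : ℝ → ℂ} (h : IsolatedZeros φ) {c : ℝ} (hc : c ≠ 0) :
    IsolatedZeros fun s => φ (c * s) := by
  intro s hs
  have : Tendsto (fun u : ℝ => c * u) (𝓝[≠] s) (𝓝[≠] (c * s)) := by
    refine tendsto_nhdsWithin_iff.2 ⟨((continuous_const_mul c).tendsto s).mono_left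
      nhdsWithin_le_nhds, ?_⟩
    filter_upwards [self_mem_nhdsWithin] with u hu
    simpa [hc] using hu
  exact this.eventually (h _ hs)

/-- A discrete subspace of the real line is Lindelöf, hence countable. This permits integrating a
derivative that is known only off the zeros. -/
lemma IsolatedZeros.countable {φ : ℝ → ℂ} (h : IsolatedZeros φ) : {s | φ s = 0}.Countable := by
  have : DiscreteTopology {s | φ s = 0} := by
    rw [discreteTopology_subtype_iff]
    intro s hs
    rw [← disjoint_iff, Filter.disjoint_principal_right]
    exact h s hs
  exact Set.countable_coe_iff.1 (countable_of_Lindelof_of_discrete (X := {s | φ s = 0}))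

/-- If the Wronskian of `f` and `h` vanishes and the zeros of `f` are isolated and simple, then
`f` and `h` are proportional. -/
lemma eq_of_wronskian_eq_zero {f f' h h' : ℝ → ℂ} (hf : ∀ s, HasDerivAt f (f' s) s)
    (hh : ∀ s, HasDerivAt h (h' s) s) (hz : RegularZeros f)
    (hW : ∀ s, f' s * h s = f s * h' s) (h0 : f 0 = 1) (h0' : h 0 = 1) : f = h := by
  classical
  have hfc : Continuous f := continuous_iff_continuousAt.2 fun s => (hf s).continuousAt
  have hf' : ∀ s, f s = 0 → f' s ≠ 0 := fun s hs => (hf s).deriv ▸ (hz s hs).2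
  have hhz : ∀ s, f s = 0 → h s = 0 := fun s hs => by
    have := hW s
    rw [hs, zero_mul] at this
    exact (mul_eq_zero.1 this).resolve_left (hf' s hs)
  -- The quotient `h / f`, filled in at the zeros of `f` by its l'Hôpital value.
  let r : ℝ → ℂ := fun s => if f s = 0 then h' s / f' s else h s / f s
  have hr : ∀ s, f s ≠ 0 → r =ᶠ[𝓝 s] fun u => h u / f u := fun s hs => by
    filter_upwards [hfc.continuousAt.eventually_ne hs] with u hu
    simp [r, hu]
  have hrd : ∀ s, f s ≠ 0 → HasDerivAt r 0 s := fun s hs => by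
    refine (((hh s).div (hf s) hs).congr_of_eventuallyEq (hr s hs)).congr_deriv ?_
    rw [show h' s * f s - h s * f' s = 0 by linear_combination -hW s, zero_div]
  have hrc : Continuous r := by
    refine continuous_iff_continuousAt.2 fun s => ?_
    by_cases hs : f s = 0
    -- Both functions vanish at `s`, so nearby `h / f` is a quotient of difference quotients; the
    -- limit exists because `f' s ≠ 0`.
    · rw [continuousAt_iff_punctured_nhds]
      have h1 := hasDerivAt_iff_tendsto_slope.1 (hh s)
      have h2 := hasDerivAt_iff_tendsto_slope.1 (hf s)
      have h3 := h1.div h2 (hf' s hs)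
      have : r s = h' s / f' s := by simp [r, hs]
      rw [this]
      refine h3.congr' ?_
      filter_upwards [(hz s hs).1, self_mem_nhdsWithin] with u hu hus
      have hus' : u - s ≠ 0 := sub_ne_zero.2 hus
      have hus'' : ((u : ℂ) - s) ≠ 0 := by exact_mod_cast hus'
      simp only [Pi.div_apply, slope_def_module, hs, hhz s hs, sub_zero, r, hu, if_false]
      rw [Complex.real_smul, Complex.real_smul, mul_div_mul_left]
      simpa using hus''
    · exact (hrd s hs).continuousAt
  have key : ∀ s, r s = 1 := fun s => by
    have := MeasureTheory.integral_eq_of_hasDerivAt_off_countable r (fun _ => 0)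
      (a := 0) (b := s) hz.isolatedZeros.countable hrc.continuousOn (fun x hx => hrd x hx.2)
      (by simp)
    have h1 : r 0 = 1 := by simp [r, h0, h0']
    rw [intervalIntegral.integral_zero, h1] at this
    exact (sub_eq_zero.1 this.symm)
  funext s
  by_cases hs : f s = 0
  · rw [hs, hhz s hs]
  · have := key s
    simp only [r, hs, if_false] at this
    exact ((div_eq_one_iff_eq hs).1 this).symm

/-- The analytic core of the identification of a measurement error: a factor with regular zeros of
a product is determined by the product and by the product with its derivative in its place. -/
lemma eq_of_mul_eq_of_deriv_mul_eq {f f' h h' g k : ℝ → ℂ} (hf : ∀ s, HasDerivAt f (f' s) s)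
    (hh : ∀ s, HasDerivAt h (h' s) s) (hf' : Continuous f') (hh' : Continuous h')
    (hz : RegularZeros f) (hg : IsolatedZeros g) (hgc : Continuous g)
    (e0 : ∀ s, f s * g s = h s * k s) (e1 : ∀ s, f' s * g s = h' s * k s)
    (h0 : f 0 = 1) (h0' : h 0 = 1) : f = h := by
  have hfc : Continuous f := continuous_iff_continuousAt.2 fun s => (hf s).continuousAt
  have hhc : Continuous h := continuous_iff_continuousAt.2 fun s => (hh s).continuousAt
  refine eq_of_wronskian_eq_zero hf hh hz (fun s => ?_) h0 h0'
  have hd : Dense {s | f s ≠ 0 ∧ g s ≠ 0} := fun s =>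
    mem_closure_iff_frequently.2 (((hz.isolatedZeros.eventually_ne hfc s).and
      (hg.eventually_ne hgc s)).frequently.filter_mono nhdsWithin_le_nhds)
  refine congrFun ((hf'.mul hhc).ext_on hd (hfc.mul hh') fun u hu => ?_) s
  -- Nothing is assumed about the zeros of `k`; it is nonzero here because `f * g` is.
  have hk : k u ≠ 0 := fun hk => mul_ne_zero hu.1 hu.2 (by rw [e0, hk, mul_zero])
  have : (f' u * h u - f u * h' u) * (g u * k u) = 0 := by
    linear_combination h u * k u * e1 u - h' u * k u * e0 u
  exact sub_eq_zero.1 ((mul_eq_zero.1 this).resolve_right (mul_ne_zero hu.2 hk))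

/-! ### Kotlarski-type identification of an error law, and deconvolution -/

section Deconvolution

variable {Ω Ω' : Type*} [MeasurableSpace Ω] [MeasurableSpace Ω']

lemma charFun_map_real_apply {P : Measure Ω} {X : Ω → ℝ} (hX : Measurable X) (s : ℝ) :
    charFun (P.map X) s = ∫ ω, Complex.exp (s * X ω * Complex.I) ∂P := by
  rw [charFun_apply_real, integral_map hX.aemeasurable (by fun_prop)]

lemma memLp_one_id_map {P : Measure Ω} {X : Ω → ℝ} (hX : Measurable X) (hi : Integrable X P) :
    MemLp id 1 (P.map X) := by
  rw [memLp_map_measure_iff (by fun_prop) hX.aemeasurable]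
  exact memLp_one_iff_integrable.2 hi

lemma deriv_charFun_map {P : Measure Ω} [IsFiniteMeasure P] {X : Ω → ℝ} (hX : Measurable X)
    (hi : Integrable X P) (s : ℝ) :
    deriv (charFun (P.map X)) s =
      Complex.I * ∫ ω, (X ω : ℂ) * Complex.exp (s * X ω * Complex.I) ∂P := by
  have := iteratedDeriv_charFun (t := s) (n := 1) (by exact_mod_cast memLp_one_id_map hX hi)
  rw [iteratedDeriv_one] at this
  rw [this, integral_map hX.aemeasurable (by fun_prop)]
  simp

lemma contDiff_one_charFun_map {P : Measure Ω} [IsFiniteMeasure P] {X : Ω → ℝ}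
    (hX : Measurable X) (hi : Integrable X P) : ContDiff ℝ 1 (charFun (P.map X)) :=
  contDiff_charFun (n := 1) (by exact_mod_cast memLp_one_id_map hX hi)

lemma integrable_mul_exp {P : Measure Ω} {X U : Ω → ℝ} (hU : Measurable U)
    (hX : Integrable X P) :
    Integrable (fun ω => (X ω : ℂ) * Complex.exp (U ω * Complex.I)) P := by
  refine hX.ofReal.mul_bdd (c := 1) (by fun_prop) (ae_of_all _ fun ω => ?_)
  rw [Complex.norm_exp_ofReal_mul_I]

/-- The characteristic function of a contrast of two measurements that removes the latent
variable. -/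
lemma integral_exp_contrast {P : Measure Ω} [IsProbabilityMeasure P] {e₁ e₂ W : Ω → ℝ}
    (h₁ : Measurable e₁) (h₂ : Measurable e₂) (hI : IndepFun e₁ e₂ P) {c l : ℝ} (hl : l ≠ 0)
    (s : ℝ) :
    ∫ ω, Complex.exp ((s * ((W ω + e₁ ω) - (c + l * W ω + e₂ ω - c) / l) : ℝ) * Complex.I) ∂P =
      charFun (P.map e₁) s * charFun (P.map e₂) (-l⁻¹ * s) := by
  rw [charFun_map_real_apply h₁, charFun_map_real_apply h₂,
    ← hI.integral_fun_comp_mul_comp (f := fun x : ℝ => Complex.exp (s * x * Complex.I))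
      (g := fun x : ℝ => Complex.exp ((-l⁻¹ * s : ℝ) * x * Complex.I)) h₁.aemeasurable
      h₂.aemeasurable (by fun_prop) (by fun_prop)]
  congr 1 with ω
  rw [← Complex.exp_add]
  congr 1
  have hl' : (l : ℂ) ≠ 0 := by exact_mod_cast hl
  push_cast
  field_simp
  ring

/-- The contrast equals `e₁ - e₂ / l`, which is independent of `W`. The weight `W` therefore
contributes only its mean, while the weight `e₁` differentiates the characteristic function of `e₁`.
-/
lemma integral_mul_exp_contrast {P : Measure Ω} [IsProbabilityMeasure P] {e₁ e₂ W : Ω → ℝ}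
    (h₁ : Measurable e₁) (h₂ : Measurable e₂) (hW : Measurable W) (hI : IndepFun e₁ e₂ P)
    (hIW : IndepFun W (fun ω => (e₁ ω, e₂ ω)) P) (iW : Integrable W P) (i₁ : Integrable e₁ P)
    {c l : ℝ} (hl : l ≠ 0) (s : ℝ) :
    ∫ ω, ((W ω + e₁ ω : ℝ) : ℂ) *
        Complex.exp ((s * ((W ω + e₁ ω) - (c + l * W ω + e₂ ω - c) / l) : ℝ) * Complex.I) ∂P =
      (∫ ω, W ω ∂P : ℝ) * (charFun (P.map e₁) s * charFun (P.map e₂) (-l⁻¹ * s)) +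
      -Complex.I * (deriv (charFun (P.map e₁)) s * charFun (P.map e₂) (-l⁻¹ * s)) := by
  have hl' : (l : ℂ) ≠ 0 := by exact_mod_cast hl
  have e : ∀ ω, ((W ω + e₁ ω : ℝ) : ℂ) *
        Complex.exp ((s * ((W ω + e₁ ω) - (c + l * W ω + e₂ ω - c) / l) : ℝ) * Complex.I) =
      (W ω : ℂ) * Complex.exp ((s * (e₁ ω - e₂ ω / l) : ℝ) * Complex.I) +
      (e₁ ω : ℂ) * Complex.exp ((s * (e₁ ω - e₂ ω / l) : ℝ) * Complex.I) := fun ω => by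
    rw [← add_mul, ← Complex.ofReal_add]
    congr 5
    field_simp
    ring
  simp_rw [e]
  rw [integral_add (integrable_mul_exp (by fun_prop) iW) (integrable_mul_exp (by fun_prop) i₁)]
  congr 1
  · rw [← integral_exp_contrast (W := W) (c := c) h₁ h₂ hI hl]
    have := hIW.integral_fun_comp_mul_comp (f := fun x : ℝ => (x : ℂ))
      (g := fun x : ℝ × ℝ => Complex.exp ((s * (x.1 - x.2 / l) : ℝ) * Complex.I)) hW.aemeasurable
      (h₁.prodMk h₂).aemeasurable (by fun_prop) (by fun_prop)
    rw [this, integral_complex_ofReal]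
    congr 2 with ω
    congr 3
    field_simp
    ring
  · rw [deriv_charFun_map h₁ i₁, charFun_map_real_apply h₂, mul_assoc, ← mul_assoc, neg_mul,
      Complex.I_mul_I, neg_neg, one_mul,
      ← hI.integral_fun_comp_mul_comp (f := fun x : ℝ => (x : ℂ) * Complex.exp (s * x * Complex.I))
      (g := fun x : ℝ => Complex.exp ((-l⁻¹ * s : ℝ) * x * Complex.I)) h₁.aemeasurable
      h₂.aemeasurable (by fun_prop) (by fun_prop)]
    congr 1 with ω
    rw [mul_assoc, ← Complex.exp_add]
    congr 2
    push_cast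
    field_simp
    ring

/-- Extension of Kotlarski's lemma: the law of the error of a measurement is determined by the joint
law of two measurements of the same latent variable. -/
lemma map_error_eq_of_map_measurements_eq {P : Measure Ω} [IsProbabilityMeasure P]
    {P' : Measure Ω'} [IsProbabilityMeasure P'] {e₁ e₂ W : Ω → ℝ} {e₁' e₂' W' : Ω' → ℝ}
    (h₁ : Measurable e₁) (h₂ : Measurable e₂) (hW : Measurable W) (hI : IndepFun e₁ e₂ P)
    (hIW : IndepFun W (fun ω => (e₁ ω, e₂ ω)) P) (iW : Integrable W P) (i₁ : Integrable e₁ P)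
    (m₁ : ∫ ω, e₁ ω ∂P = 0)
    (h₁' : Measurable e₁') (h₂' : Measurable e₂') (hW' : Measurable W') (hI' : IndepFun e₁' e₂' P')
    (hIW' : IndepFun W' (fun ω => (e₁' ω, e₂' ω)) P') (iW' : Integrable W' P')
    (i₁' : Integrable e₁' P') (m₁' : ∫ ω, e₁' ω ∂P' = 0)
    {c l : ℝ} (hl : l ≠ 0) (hz₁ : RegularZeros (charFun (P.map e₁)))
    (hz₂ : IsolatedZeros (charFun (P.map e₂)))
    (hlaw : P.map (fun ω => (W ω + e₁ ω, c + l * W ω + e₂ ω)) =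
      P'.map (fun ω => (W' ω + e₁' ω, c + l * W' ω + e₂' ω))) :
    P.map e₁ = P'.map e₁' := by
  have hZ : Measurable fun ω => (W ω + e₁ ω, c + l * W ω + e₂ ω) := by fun_prop
  have hZ' : Measurable fun ω => (W' ω + e₁' ω, c + l * W' ω + e₂' ω) := by fun_prop
  have tr : ∀ F : ℝ × ℝ → ℂ, Measurable F → ∫ ω, F (W ω + e₁ ω, c + l * W ω + e₂ ω) ∂P =
      ∫ ω, F (W' ω + e₁' ω, c + l * W' ω + e₂' ω) ∂P' := fun F hF => by
    rw [← integral_map (f := F) hZ.aemeasurable hF.aestronglyMeasurable, hlaw,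
      integral_map hZ'.aemeasurable hF.aestronglyMeasurable]
  -- The errors are centred, so the latent mean is that of the first measurement; the mean term can
  -- then be cancelled from the weighted identity.
  have hEW : ∫ ω, W ω ∂P = ∫ ω, W' ω ∂P' := by
    have h := tr (fun z => (z.1 : ℂ)) (by fun_prop)
    simp only [integral_complex_ofReal] at h
    have h := Complex.ofReal_injective h
    rwa [integral_add iW i₁, integral_add iW' i₁', m₁, m₁', add_zero, add_zero] at h
  have e0 : ∀ s, charFun (P.map e₁) s * charFun (P.map e₂) (-l⁻¹ * s) =
      charFun (P'.map e₁') s * charFun (P'.map e₂') (-l⁻¹ * s) := fun s => by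
    rw [← integral_exp_contrast (W := W) (c := c) h₁ h₂ hI hl,
      ← integral_exp_contrast (W := W') (c := c) h₁' h₂' hI' hl]
    exact tr (fun z => Complex.exp ((s * (z.1 - (z.2 - c) / l) : ℝ) * Complex.I)) (by fun_prop)
  have e1 : ∀ s, deriv (charFun (P.map e₁)) s * charFun (P.map e₂) (-l⁻¹ * s) =
      deriv (charFun (P'.map e₁')) s * charFun (P'.map e₂') (-l⁻¹ * s) := fun s => by
    have h := tr (fun z => (z.1 : ℂ) *
      Complex.exp ((s * (z.1 - (z.2 - c) / l) : ℝ) * Complex.I)) (by fun_prop)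
    simp only at h
    rw [integral_mul_exp_contrast h₁ h₂ hW hI hIW iW i₁ hl,
      integral_mul_exp_contrast h₁' h₂' hW' hI' hIW' iW' i₁' hl, hEW, e0] at h
    exact mul_left_cancel₀ (neg_ne_zero.2 Complex.I_ne_zero) (add_left_cancel h)
  have C := contDiff_one_charFun_map h₁ i₁
  have C' := contDiff_one_charFun_map h₁' i₁'
  have := Measure.isProbabilityMeasure_map (μ := P) h₁.aemeasurable
  have := Measure.isProbabilityMeasure_map (μ := P) h₂.aemeasurable
  have := Measure.isProbabilityMeasure_map (μ := P') h₁'.aemeasurable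
  refine Measure.ext_of_charFun (eq_of_mul_eq_of_deriv_mul_eq
    (fun s => (C.differentiable one_ne_zero s).hasDerivAt)
    (fun s => (C'.differentiable one_ne_zero s).hasDerivAt)
    (C.continuous_deriv le_rfl) (C'.continuous_deriv le_rfl) hz₁
    (hz₂.comp_mul (neg_ne_zero.2 (inv_ne_zero hl)))
    (continuous_charFun.comp (continuous_const_mul _)) e0 e1 ?_ ?_)
  · simp
  · simp

lemma charFun_map_latent_add_error {ι : Type*} [Fintype ι] {P : Measure Ω}
    [IsProbabilityMeasure P] {e X : ι → Ω → ℝ} (he : ∀ i, Measurable (e i))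
    (hX : ∀ i, Measurable (X i)) (hI : iIndepFun e P)
    (hIX : IndepFun (fun ω i => X i ω) (fun ω i => e i ω) P) (t : ι → ℝ) :
    charFun ((P.map (fun ω i => X i ω + e i ω)).map (WithLp.toLp 2)) (WithLp.toLp 2 t) =
      charFun ((P.map (fun ω i => X i ω)).map (WithLp.toLp 2)) (WithLp.toLp 2 t) *
        ∏ i, charFun (P.map (e i)) (t i) := by
  have h1 := (iIndepFun_iff_charFun_pi (fun i => (he i).aemeasurable)).1 hI (WithLp.toLp 2 t)
  have h2 := (hIX.comp (φ := WithLp.toLp 2) (ψ := WithLp.toLp 2) (by fun_prop)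
    (by fun_prop)).charFun_map_fun_add_eq_mul (by fun_prop) (by fun_prop)
  have h3 := congrFun h2 (WithLp.toLp 2 t)
  rw [Pi.mul_apply] at h3
  rw [Measure.map_map (by fun_prop) (by fun_prop), Measure.map_map (by fun_prop) (by fun_prop)]
  exact Eq.trans h3 (congrArg₂ _ rfl h1)

/-- Deconvolution: the law of a latent vector is determined by the law of the vector of its
measurements and the laws of the independent errors, if the zeros of the characteristic functions
of the errors are isolated. -/
lemma map_latent_eq_of_map_measurements_eq {ι : Type*} [Fintype ι]
    {P : Measure Ω} [IsProbabilityMeasure P] {P' : Measure Ω'} [IsProbabilityMeasure P']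
    {e X : ι → Ω → ℝ} {e' X' : ι → Ω' → ℝ}
    (he : ∀ i, Measurable (e i)) (hX : ∀ i, Measurable (X i)) (hI : iIndepFun e P)
    (hIX : IndepFun (fun ω i => X i ω) (fun ω i => e i ω) P)
    (he' : ∀ i, Measurable (e' i)) (hX' : ∀ i, Measurable (X' i)) (hI' : iIndepFun e' P')
    (hIX' : IndepFun (fun ω i => X' i ω) (fun ω i => e' i ω) P')
    (herr : ∀ i, P.map (e i) = P'.map (e' i))
    (hz : ∀ i, IsolatedZeros (charFun (P.map (e i))))
    (hlaw : P.map (fun ω i => X i ω + e i ω) = P'.map (fun ω i => X' i ω + e' i ω)) :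
    P.map (fun ω i => X i ω) = P'.map (fun ω i => X' i ω) := by
  have := Measure.isProbabilityMeasure_map (μ := P) (f := fun ω i => X i ω) (by fun_prop)
  have := Measure.isProbabilityMeasure_map (μ := P') (f := fun ω i => X' i ω) (by fun_prop)
  have := fun i => Measure.isProbabilityMeasure_map (μ := P) (he i).aemeasurable
  refine (MeasurableEquiv.toLp 2 (ι → ℝ)).map_measurableEquiv_injective
    (Measure.ext_of_charFun (funext fun t => ?_))
  -- A product of dense sets is dense, so the error factor can be cancelled on a dense set, and
  -- continuity extends the equality.
  have hd : Dense (Set.univ.pi fun i => {s | charFun (P.map (e i)) s ≠ 0}) :=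
    dense_pi _ fun i _ => (hz i).dense continuous_charFun
  have hc : ∀ ν : Measure (ι → ℝ), IsProbabilityMeasure ν →
      Continuous fun t : ι → ℝ => charFun (ν.map (WithLp.toLp 2)) (WithLp.toLp 2 t) := fun ν _ =>
    have := Measure.isProbabilityMeasure_map (μ := ν) (f := WithLp.toLp 2) (by fun_prop)
    continuous_charFun.comp (PiLp.continuous_toLp 2 _)
  refine congrFun ((hc _ ‹_›).ext_on hd (hc _ ‹_›) fun s hs => ?_) t.ofLp
  have hne : ∏ i, charFun (P.map (e i)) (s i) ≠ 0 :=
    Finset.prod_ne_zero_iff.2 fun i _ => hs i trivial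
  refine mul_right_cancel₀ hne ?_
  rw [← charFun_map_latent_add_error he hX hI hIX, hlaw,
    charFun_map_latent_add_error he' hX' hI' hIX']
  simp_rw [herr]

end Deconvolution

/-- Splitting off one index at a time factorizes any finite intersection. This reduces mutual
independence to independence of two blocks, which is what can be transferred to the fibres of a
disintegration. -/
lemma iIndepFun_of_forall_finset {ι : Type*} [DecidableEq ι] {Ω : Type*} [MeasurableSpace Ω]
    {P : Measure Ω}
    [IsProbabilityMeasure P] {f : ι → Ω → ℝ}
    (h : ∀ S T : Finset ι, Disjoint S T →
      IndepFun (fun ω (i : S) => f i ω) (fun ω (i : T) => f i ω) P) : iIndepFun f P := by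
  rw [iIndepFun_iff_measure_inter_preimage_eq_mul]
  intro S
  induction S using Finset.induction_on with
  | empty => simp
  | insert a S ha ih =>
    intro A hA
    have h1 := (h {a} S (by simpa using ha)).measure_inter_preimage_eq_mul
      {x | x ⟨a, Finset.mem_singleton_self a⟩ ∈ A a} {x | ∀ i : S, x i ∈ A i}
      (measurable_pi_apply _ (hA a (Finset.mem_insert_self a S)))
      (by
        rw [Set.ofPred_forall]
        exact MeasurableSet.iInter fun i => measurable_pi_apply _
          (hA i (Finset.mem_insert_of_mem i.2)))
    have h2 := ih fun i hi => hA i (Finset.mem_insert_of_mem hi)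
    have e1 : (fun ω (i : S) => f i ω) ⁻¹' {x | ∀ i : S, x i ∈ A i} = ⋂ i ∈ S, f i ⁻¹' A i := by
      ext ω
      simp
    rw [e1, h2] at h1
    rw [Finset.set_biInter_insert, Finset.prod_insert ha]
    exact h1

/-! ### Conditional assumptions as statements about almost every fibre -/

section Disintegration

variable {Ω Ω' γ : Type*} [MeasurableSpace Ω] [StandardBorelSpace Ω] [Nonempty Ω]
  [MeasurableSpace Ω'] [StandardBorelSpace Ω'] [Nonempty Ω'] [MeasurableSpace γ]

/-- Disintegrating the whole space over `k` yields one family of probability measures from which all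
conditional laws arise as images, so the unconditional lemmas apply on each fibre. -/
lemma condDistrib_ae_eq_map_condDistrib_id {P : Measure Ω} [IsProbabilityMeasure P] {k : Ω → γ}
    {β : Type*} [MeasurableSpace β] [StandardBorelSpace β] [Nonempty β] {f : Ω → β}
    (hf : Measurable f) :
    ∀ᵐ y ∂P.map k, condDistrib f k P y = (condDistrib id k P y).map f := by
  filter_upwards [condDistrib_comp (μ := P) k aemeasurable_id hf] with y hy
  rw [Function.comp_id] at hy
  rw [hy, Kernel.map_apply _ hf]

lemma CondIndepFun.ae_indepFun_condDistrib {P : Measure Ω} [IsProbabilityMeasure P] {k : Ω → γ}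
    (hk : Measurable k) {β β' : Type*} [MeasurableSpace β] [StandardBorelSpace β] [Nonempty β]
    [MeasurableSpace β'] [StandardBorelSpace β'] [Nonempty β'] {f : Ω → β} {g : Ω → β'}
    (hf : Measurable f) (hg : Measurable g)
    (h : CondIndepFun (MeasurableSpace.comap k inferInstance) hk.comap_le f g P) :
    ∀ᵐ y ∂P.map k, IndepFun f g (condDistrib id k P y) := by
  rw [condIndepFun_iff_map_prod_eq_prod_condDistrib_prod_condDistrib hf hg hk,
    ← Measure.compProd_eq_comp_prod] at h
  filter_upwards [condDistrib_ae_eq_of_measure_eq_compProd k (hf.prodMk hg).aemeasurable h,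
    condDistrib_ae_eq_map_condDistrib_id (P := P) (k := k) hf,
    condDistrib_ae_eq_map_condDistrib_id (P := P) (k := k) hg,
    condDistrib_ae_eq_map_condDistrib_id (P := P) (k := k) (hf.prodMk hg)] with y h1 h2 h3 h4
  rw [indepFun_iff_map_prod_eq_prod_map_map hf.aemeasurable hg.aemeasurable, ← h4, h1,
    Kernel.prod_apply, h2, h3]

lemma iCondIndepFun.ae_iIndepFun_condDistrib {ι : Type*} [Fintype ι] [DecidableEq ι]
    {P : Measure Ω} [IsProbabilityMeasure P] {k : Ω → γ} (hk : Measurable k) {f : ι → Ω → ℝ}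
    (hf : ∀ i, Measurable (f i))
    (h : iCondIndepFun (MeasurableSpace.comap k inferInstance) hk.comap_le f P) :
    ∀ᵐ y ∂P.map k, iIndepFun f (condDistrib id k P y) := by
  have : ∀ᵐ y ∂P.map k, ∀ S T : Finset ι, Disjoint S T →
      IndepFun (fun ω (i : S) => f i ω) (fun ω (i : T) => f i ω) (condDistrib id k P y) := by
    -- A single null set suffices, since a finite index set has only finitely many pairs of blocks.
    refine ae_all_iff.2 fun S => ae_all_iff.2 fun T => ?_
    by_cases hST : Disjoint S T
    · filter_upwards [CondIndepFun.ae_indepFun_condDistrib hk (by fun_prop) (by fun_prop)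
        (h.condIndepFun_finset S T hST hf)] with y hy _ using hy
    · exact ae_of_all _ fun y h => absurd h hST
  filter_upwards [this] with y hy using iIndepFun_of_forall_finset hy

lemma ae_integral_condDistrib_eq_zero {P : Measure Ω} [IsProbabilityMeasure P] {k : Ω → γ}
    (hk : Measurable k) {f : Ω → ℝ} (hf : Measurable f) (hi : Integrable f P)
    (h : P[f | MeasurableSpace.comap k inferInstance] =ᵐ[P] 0) :
    ∀ᵐ y ∂P.map k, ∫ ω, f ω ∂(condDistrib id k P y) = 0 := by
  have h1 := (condExp_ae_eq_integral_condDistrib_id hk hi).symm.trans h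
  refine (ae_map_iff hk.aemeasurable (measurableSet_eq_fun ?_ measurable_const)).2 h1
  exact (StronglyMeasurable.integral_kernel hf.stronglyMeasurable).measurable

lemma ae_integrable_condDistrib_id {P : Measure Ω} [IsProbabilityMeasure P] {k : Ω → γ}
    {f : Ω → ℝ} (hi : Integrable f P) :
    ∀ᵐ y ∂P.map k, Integrable f (condDistrib id k P y) :=
  (hi.comp_snd_map_prodMk k).condDistrib_ae_map aemeasurable_id

/-- Two pairs have the same law iff their first components have the same law and the conditional
laws of the second components agree. -/
lemma map_prodMk_eq_iff {P : Measure Ω} [IsProbabilityMeasure P] {P' : Measure Ω'}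
    [IsProbabilityMeasure P'] {k : Ω → γ} {k' : Ω' → γ} (hkk : P.map k = P'.map k')
    {β : Type*} [MeasurableSpace β] [StandardBorelSpace β] [Nonempty β] {f : Ω → β} {f' : Ω' → β}
    (hf : Measurable f) (hf' : Measurable f') :
    P.map (fun ω => (k ω, f ω)) = P'.map (fun ω => (k' ω, f' ω)) ↔
      ∀ᵐ y ∂P.map k, (condDistrib id k P y).map f = (condDistrib id k' P' y).map f' := by
  have h1 := condDistrib_ae_eq_map_condDistrib_id (P := P) (k := k) hf
  have h2 := condDistrib_ae_eq_map_condDistrib_id (P := P') (k := k') hf'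
  rw [← hkk] at h2
  rw [← compProd_map_condDistrib (μ := P') (X := k') hf'.aemeasurable, ← hkk,
    ← condDistrib_ae_eq_iff_measure_eq_compProd k hf.aemeasurable]
  constructor <;> intro h <;> filter_upwards [h, h1, h2] with y hy h1 h2
  · rw [← h1, hy, h2]
  · rw [h1, hy, h2]

/-- Two measurements, with errors `e (i, 0)` and `e (i, 1)`, of each latent variable `X i`; the
errors are jointly independent, independent of the latent variables and centred, given `k`, and the
zeros of their conditional characteristic functions are regular. -/
structure MeasurementErrors {ι : Type*} (P : Measure Ω) [IsProbabilityMeasure P] (k : Ω → γ)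
    (X : ι → Ω → ℝ) (e : ι × Fin 2 → Ω → ℝ) : Prop where
  meas_cond : Measurable k
  meas_latent : ∀ i, Measurable (X i)
  meas_err : ∀ i, Measurable (e i)
  iIndep : iCondIndepFun (MeasurableSpace.comap k inferInstance) meas_cond.comap_le e P
  indep : CondIndepFun (MeasurableSpace.comap k inferInstance) meas_cond.comap_le
    (fun ω i => e i ω) (fun ω i => X i ω) P
  integrable_latent : ∀ i, Integrable (X i) P
  integrable_err : ∀ i, Integrable (e i) P
  mean : ∀ i, P[e i | MeasurableSpace.comap k inferInstance] =ᵐ[P] 0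
  regular : ∀ i, ∀ᵐ y ∂(P.map k), RegularZeros (charFun (condDistrib (e i) k P y))

/-- The joint law of the latent variables and the conditioning variable is determined by the joint
law of the measurements and the conditioning variable. -/
theorem MeasurementErrors.map_latent_eq {ι : Type*} [Fintype ι] [DecidableEq ι]
    {P : Measure Ω} [IsProbabilityMeasure P] {P' : Measure Ω'} [IsProbabilityMeasure P']
    {k : Ω → γ} {k' : Ω' → γ} {X : ι → Ω → ℝ} {X' : ι → Ω' → ℝ} {e : ι × Fin 2 → Ω → ℝ}
    {e' : ι × Fin 2 → Ω' → ℝ} (h : MeasurementErrors P k X e) (h' : MeasurementErrors P' k' X' e')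
    {c l : ι → ℝ} (hl : ∀ i, l i ≠ 0)
    (hlaw : P.map (fun ω => (k ω, fun i => (X i ω + e (i, 0) ω, c i + l i * X i ω + e (i, 1) ω))) =
      P'.map (fun ω => (k' ω, fun i =>
        (X' i ω + e' (i, 0) ω, c i + l i * X' i ω + e' (i, 1) ω)))) :
    P.map (fun ω => (k ω, fun i => X i ω)) = P'.map (fun ω => (k' ω, fun i => X' i ω)) := by
  have := h.meas_cond; have := h.meas_latent; have := h.meas_err
  have := h'.meas_cond; have := h'.meas_latent; have := h'.meas_err
  have hkk : P.map k = P'.map k' := by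
    have := congrArg (Measure.map Prod.fst) hlaw
    rwa [Measure.map_map measurable_fst (by fun_prop), Measure.map_map measurable_fst
      (by fun_prop)] at this
  rw [map_prodMk_eq_iff hkk (by fun_prop) (by fun_prop)] at hlaw ⊢
  have reg : ∀ᵐ y ∂P.map k, ∀ i, RegularZeros (charFun ((condDistrib id k P y).map (e i))) :=
    ae_all_iff.2 fun i => by
      filter_upwards [h.regular i, condDistrib_ae_eq_map_condDistrib_id (P := P) (k := k)
        (h.meas_err i)] with y h1 h2 using h2 ▸ h1
  have A := iCondIndepFun.ae_iIndepFun_condDistrib h.meas_cond h.meas_err h.iIndep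
  have B := CondIndepFun.ae_indepFun_condDistrib h.meas_cond (by fun_prop) (by fun_prop) h.indep
  have C := ae_all_iff.2 fun i => ae_integrable_condDistrib_id (k := k) (h.integrable_latent i)
  have D := ae_all_iff.2 fun i => ae_integrable_condDistrib_id (k := k) (h.integrable_err i)
  have E := ae_all_iff.2 fun i =>
    ae_integral_condDistrib_eq_zero h.meas_cond (h.meas_err i) (h.integrable_err i) (h.mean i)
  have A' := iCondIndepFun.ae_iIndepFun_condDistrib h'.meas_cond h'.meas_err h'.iIndep
  have B' := CondIndepFun.ae_indepFun_condDistrib h'.meas_cond (by fun_prop) (by fun_prop) h'.indep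
  have C' := ae_all_iff.2 fun i => ae_integrable_condDistrib_id (k := k') (h'.integrable_latent i)
  have D' := ae_all_iff.2 fun i => ae_integrable_condDistrib_id (k := k') (h'.integrable_err i)
  have E' := ae_all_iff.2 fun i =>
    ae_integral_condDistrib_eq_zero h'.meas_cond (h'.meas_err i) (h'.integrable_err i) (h'.mean i)
  -- The conditioning variables have the same law, so the two fibres over the same `y` can be
  -- compared.
  rw [← hkk] at A' B' C' D' E'
  filter_upwards [hlaw, reg, A, B, C, D, E, A', B', C', D', E'] with
    y hlaw reg A B C D E A' B' C' D' E'
  have herr : ∀ i, (condDistrib id k P y).map (e (i, 0)) =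
      (condDistrib id k' P' y).map (e' (i, 0)) := fun i => by
    have hψ : Measurable fun x : ι × Fin 2 → ℝ => (x (i, 0), x (i, 1)) := by fun_prop
    refine map_error_eq_of_map_measurements_eq (h.meas_err _) (h.meas_err (i, 1)) (h.meas_latent i)
      (A.indepFun (by simp)) (B.symm.comp (measurable_pi_apply i) hψ) (C i) (D _) (E _)
      (h'.meas_err _) (h'.meas_err (i, 1)) (h'.meas_latent i)
      (A'.indepFun (by simp)) (B'.symm.comp (measurable_pi_apply i) hψ) (C' i) (D' _) (E' _)
      (c := c i) (hl i) (reg _)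
        (reg _).isolatedZeros ?_
    have := congrArg (Measure.map fun x => x i) hlaw
    rwa [Measure.map_map (by fun_prop) (by fun_prop),
      Measure.map_map (by fun_prop) (by fun_prop)] at this
  -- The second measurements have served to identify the first errors; deconvolution uses only the
  -- first measurements.
  have inj : Function.Injective fun i : ι => (i, (0 : Fin 2)) := Prod.mk_left_injective 0
  have hψ : Measurable fun (x : ι × Fin 2 → ℝ) (i : ι) => x (i, 0) := by fun_prop
  refine map_latent_eq_of_map_measurements_eq (fun i => h.meas_err (i, 0)) h.meas_latent
    (A.precomp inj)
    (B.symm.comp measurable_id hψ)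
    (fun i => h'.meas_err (i, 0)) h'.meas_latent (A'.precomp inj)
    (B'.symm.comp measurable_id hψ) herr
    (fun i => (reg _).isolatedZeros) ?_
  have := congrArg (Measure.map fun x i => (x i).1) hlaw
  rwa [Measure.map_map (by fun_prop) (by fun_prop),
    Measure.map_map (by fun_prop) (by fun_prop)] at this

end Disintegration

/-! ### Algebra of the rescaled parameters -/

section Parameters

variable {T : ℕ}

/-- The first measure of each latent variable is normalized to have intercept `0` and loading
`1`. -/
structure Params.IsNormalized (p : Params T) : Prop where
  muS : ∀ t, p.muS t 0 = 0
  lamS : ∀ t, p.lamS t 0 = 1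
  muI : ∀ t, p.muI t 0 = 0
  lamI : ∀ t, p.lamI t 0 = 1

lemma Params.NonzeroLoadings.isNormalized_tilde {p : Params T} (hp : p.NonzeroLoadings) :
    p.tilde.IsNormalized where
  muS t := by simp [Params.tilde, hp.1 t 0]
  lamS t := by simp [Params.tilde, hp.1 t 0]
  muI t := by simp [Params.tilde, hp.2 t 0]
  lamI t := by simp [Params.tilde, hp.2 t 0]

lemma Params.NonzeroLoadings.tilde {p : Params T} (hp : p.NonzeroLoadings) :
    p.tilde.NonzeroLoadings :=
  ⟨fun t m => div_ne_zero (hp.1 t m) (hp.1 t 0), fun t m => div_ne_zero (hp.2 t m) (hp.2 t 0)⟩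

lemma Params.IsNormalized.tilde_eq {p : Params T} (hp : p.IsNormalized) : p.tilde = p := by
  ext <;> simp [Params.tilde, hp.muS, hp.lamS, hp.muI, hp.lamI]

/-- This identity and its four analogues below characterize the rescaled coefficients: they are
those of the same equations in units of the first measures. The invariance proofs use these
identities instead of the explicit formulas. -/
lemma Params.tilde_measureS {p : Params T} (hp : p.NonzeroLoadings) (t : Fin (T + 1)) (m : Fin 2)
    (w : ℝ) : p.tilde.muS t m + p.tilde.lamS t m * (p.muS t 0 + p.lamS t 0 * w) =
      p.muS t m + p.lamS t m * w := by
  have := hp.1 t 0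
  simp only [Params.tilde]
  field_simp
  ring

lemma Params.tilde_measureI {p : Params T} (hp : p.NonzeroLoadings) (t : Fin T) (m : Fin 2)
    (x : ℝ) : p.tilde.muI t m + p.tilde.lamI t m * (p.muI t 0 + p.lamI t 0 * x) =
      p.muI t m + p.lamI t m * x := by
  have := hp.2 t 0
  simp only [Params.tilde]
  field_simp
  ring

lemma Params.tilde_outcome {p : Params T} (hp : p.NonzeroLoadings) (w : ℝ) :
    p.tilde.rho0 + p.tilde.rho1 * (p.muS (Fin.last T) 0 + p.lamS (Fin.last T) 0 * w) =
      p.rho0 + p.rho1 * w := by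
  have := hp.1 (Fin.last T) 0
  simp only [Params.tilde]
  field_simp
  ring

lemma Params.tilde_investment {p : Params T} (hp : p.NonzeroLoadings) (t : Fin T) (w y : ℝ) :
    p.tilde.beta0 t + p.tilde.beta1 t * (p.muS t.castSucc 0 + p.lamS t.castSucc 0 * w)
        + p.tilde.beta2 t * y =
      p.muI t 0 + p.lamI t 0 * (p.beta0 t + p.beta1 t * w + p.beta2 t * y) := by
  have := hp.1 t.castSucc 0
  simp only [Params.tilde]
  field_simp
  ring

lemma Params.tilde_production {p : Params T} (hp : p.NonzeroLoadings) (t : Fin T) (w x : ℝ) :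
    p.tilde.a t + p.tilde.gam1 t * (p.muS t.castSucc 0 + p.lamS t.castSucc 0 * w)
        + p.tilde.gam2 t * (p.muI t 0 + p.lamI t 0 * x)
        + p.tilde.gam3 t * (p.muS t.castSucc 0 + p.lamS t.castSucc 0 * w)
          * (p.muI t 0 + p.lamI t 0 * x) =
      p.muS t.succ 0 + p.lamS t.succ 0 * (p.a t + p.gam1 t * w + p.gam2 t * x
        + p.gam3 t * w * x) := by
  have := hp.1 t.castSucc 0
  have := hp.2 t 0
  simp only [Params.tilde]
  field_simp
  ring

/-- The parameters with given rescaled parameters `r` and given intercepts and loadings of the first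
measures. -/
def Params.rebase (r : Params T) (muS lamS : Fin (T + 1) → ℝ) (muI lamI : Fin T → ℝ) :
    Params T where
  muS t m := r.muS t m + r.lamS t m * muS t
  lamS t m := r.lamS t m * lamS t
  muI t m := r.muI t m + r.lamI t m * muI t
  lamI t m := r.lamI t m * lamI t
  rho0 := r.rho0 + r.rho1 * muS (Fin.last T)
  rho1 := r.rho1 * lamS (Fin.last T)
  beta0 t := (r.beta0 t + r.beta1 t * muS t.castSucc - muI t) / lamI t
  beta1 t := r.beta1 t * lamS t.castSucc / lamI t
  beta2 t := r.beta2 t / lamI t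
  a t := (r.a t + r.gam1 t * muS t.castSucc + r.gam2 t * muI t
    + r.gam3 t * muS t.castSucc * muI t - muS t.succ) / lamS t.succ
  gam1 t := (r.gam1 t + r.gam3 t * muI t) * lamS t.castSucc / lamS t.succ
  gam2 t := (r.gam2 t + r.gam3 t * muS t.castSucc) * lamI t / lamS t.succ
  gam3 t := r.gam3 t * lamS t.castSucc * lamI t / lamS t.succ

lemma Params.rebase_tilde {q : Params T} (hq : q.NonzeroLoadings) :
    q.tilde.rebase (q.muS · 0) (q.lamS · 0) (q.muI · 0) (q.lamI · 0) = q := by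
  have hS := fun t => hq.1 t 0
  have hI := fun t => hq.2 t 0
  ext <;> simp only [Params.tilde, Params.rebase] <;> field_simp [hS, hI] <;> ring

/-- Normalization of `r` is essential, as rescaled parameters with nonzero loadings are always
normalized. -/
lemma Params.IsNormalized.tilde_rebase {r : Params T} (hr : r.IsNormalized)
    {muS lamS : Fin (T + 1) → ℝ} {muI lamI : Fin T → ℝ} (hS : ∀ t, lamS t ≠ 0)
    (hI : ∀ t, lamI t ≠ 0) : (r.rebase muS lamS muI lamI).tilde = r := by
  ext <;> simp only [Params.tilde, Params.rebase, hr.muS, hr.lamS, hr.muI, hr.lamI, one_mul,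
    zero_add] <;> field_simp [hS, hI] <;> ring

lemma Params.NonzeroLoadings.rebase {r : Params T} (hr : r.NonzeroLoadings)
    {muS lamS : Fin (T + 1) → ℝ} {muI lamI : Fin T → ℝ} (hS : ∀ t, lamS t ≠ 0)
    (hI : ∀ t, lamI t ≠ 0) : (r.rebase muS lamS muI lamI).NonzeroLoadings :=
  ⟨fun t m => mul_ne_zero (hr.1 t m) (hS t), fun t m => mul_ne_zero (hr.2 t m) (hI t)⟩

end Parameters

/-! ### Supports in the positive orthant and logarithmic coordinates -/

section Support

/-- The coordinates of a triple are positive. -/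
def IsPosTriple (z : ℝ × ℝ × ℝ) : Prop := 0 < z.1 ∧ 0 < z.2.1 ∧ 0 < z.2.2

lemma IsPosTriple.eventually {x : ℝ × ℝ × ℝ} (hx : IsPosTriple x) : ∀ᶠ z in 𝓝 x, IsPosTriple z :=
  ((continuous_fst.tendsto x).eventually (lt_mem_nhds hx.1)).and
    ((((continuous_fst.comp continuous_snd).tendsto x).eventually (lt_mem_nhds hx.2.1)).and
      (((continuous_snd.comp continuous_snd).tendsto x).eventually (lt_mem_nhds hx.2.2)))

/-- The ball has positive measure and almost every point is positive, so some point of the ball is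
positive. Around it the logarithms are continuous. -/
lemma exists_isPosTriple_eventually_mem_support {ν : Measure (ℝ × ℝ × ℝ)}
    (hpos : ∀ᵐ z ∂ν, IsPosTriple z) {x : ℝ × ℝ × ℝ} {r : ℝ} (hr : 0 < r)
    (h : Metric.ball x r ⊆ ν.support) :
    ∃ x, IsPosTriple x ∧ ∀ᶠ z in 𝓝 x, z ∈ ν.support := by
  have hx : 0 < ν (Metric.ball x r) :=
    (Measure.mem_support_iff_forall x).1 (h (Metric.mem_ball_self hr)) _ (Metric.ball_mem_nhds x hr)
  obtain ⟨z, hz, hzp⟩ := ((frequently_ae_mem_iff.2 hx.ne').and_eventually hpos).exists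
  exact ⟨z, hzp, Filter.mem_of_superset (Metric.isOpen_ball.mem_nhds hz) h⟩

/-- Rescaling of log skills and log investment. -/
def logAffine (c d c' d' : ℝ) (z : ℝ × ℝ × ℝ) : ℝ × ℝ × ℝ :=
  (Real.exp (c + d * Real.log z.1), Real.exp (c' + d' * Real.log z.2.1), z.2.2)

lemma measurable_logAffine (c d c' d' : ℝ) : Measurable (logAffine c d c' d') := by
  unfold logAffine
  fun_prop

lemma continuousAt_logAffine (c d c' d' : ℝ) {z : ℝ × ℝ × ℝ} (hz : IsPosTriple z) :
    ContinuousAt (logAffine c d c' d') z := by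
  have h1 : ContinuousAt (fun z : ℝ × ℝ × ℝ => Real.log z.1) z :=
    ContinuousAt.log continuousAt_fst hz.1.ne'
  have h2 : ContinuousAt (fun z : ℝ × ℝ × ℝ => Real.log z.2.1) z :=
    ContinuousAt.log (by fun_prop) hz.2.1.ne'
  unfold logAffine
  fun_prop

lemma IsPosTriple.logAffine (c d c' d' : ℝ) {z : ℝ × ℝ × ℝ} (hz : IsPosTriple z) :
    IsPosTriple (logAffine c d c' d' z) :=
  ⟨Real.exp_pos _, Real.exp_pos _, hz.2.2⟩

lemma logAffine_inverse (c c' : ℝ) {d d' : ℝ} (hd : d ≠ 0) (hd' : d' ≠ 0) {z : ℝ × ℝ × ℝ}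
    (hz : IsPosTriple z) :
    SkillFormation.logAffine c d c' d' (SkillFormation.logAffine (-c / d) d⁻¹ (-c' / d') d'⁻¹ z) =
      z := by
  ext
  · simp only [SkillFormation.logAffine, Real.log_exp]
    rw [show c + d * (-c / d + d⁻¹ * Real.log z.1) = Real.log z.1 by field_simp; ring,
      Real.exp_log hz.1]
  · simp only [SkillFormation.logAffine, Real.log_exp]
    rw [show c' + d' * (-c' / d' + d'⁻¹ * Real.log z.2.1) = Real.log z.2.1 by field_simp; ring,
      Real.exp_log hz.2.1]
  · rfl

/-- On the positive orthant the rescaling is continuous with a continuous inverse of the same form.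
Continuity carries support points forward, and the inverse pulls a neighbourhood of the image point
back into the original support. -/
lemma exists_ball_subset_support_map_logAffine {ν : Measure (ℝ × ℝ × ℝ)}
    (hpos : ∀ᵐ z ∂ν, IsPosTriple z) {x : ℝ × ℝ × ℝ} {r : ℝ} (hr : 0 < r)
    (h : Metric.ball x r ⊆ ν.support) (c c' : ℝ) {d d' : ℝ} (hd : d ≠ 0) (hd' : d' ≠ 0) :
    ∃ (x : ℝ × ℝ × ℝ) (r : ℝ), 0 < r ∧
      Metric.ball x r ⊆ (ν.map (logAffine c d c' d')).support := by
  obtain ⟨x, hx, hxs⟩ := exists_isPosTriple_eventually_mem_support hpos hr h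
  have hm := measurable_logAffine c d c' d'
  have key : ∀ z, IsPosTriple z → z ∈ ν.support →
      logAffine c d c' d' z ∈ (ν.map (logAffine c d c' d')).support := fun z hz hzs => by
    rw [Measure.mem_support_iff_forall] at hzs ⊢
    intro U hU
    obtain ⟨V, hVU, hV, hzV⟩ := mem_nhds_iff.1 hU
    refine lt_of_lt_of_le ?_ (measure_mono hVU)
    rw [Measure.map_apply hm hV.measurableSet]
    exact hzs _ (continuousAt_logAffine c d c' d' hz (hV.mem_nhds hzV))
  set y := logAffine c d c' d' x
  have hy : IsPosTriple y := hx.logAffine c d c' d'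
  have hyx : logAffine (-c / d) d⁻¹ (-c' / d') d'⁻¹ y = x := by
    have := logAffine_inverse (-c / d) (-c' / d') (inv_ne_zero hd) (inv_ne_zero hd') hx
    have e1 : -(-c / d) / d⁻¹ = c := by field_simp
    have e2 : -(-c' / d') / d'⁻¹ = c' := by field_simp
    rwa [e1, e2, inv_inv, inv_inv] at this
  have hc := continuousAt_logAffine (-c / d) d⁻¹ (-c' / d') d'⁻¹ hy
  rw [ContinuousAt, hyx] at hc
  have hev : ∀ᶠ z in 𝓝 y, z ∈ (ν.map (logAffine c d c' d')).support := by
    filter_upwards [hc.eventually hxs, hy.eventually] with z hz hzp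
    have := key _ (hzp.logAffine (-c / d) d⁻¹ (-c' / d') d'⁻¹) hz
    rwa [logAffine_inverse c c' hd hd' hzp] at this
  obtain ⟨ε, hε, hb⟩ := Metric.eventually_nhds_iff_ball.1 hev
  exact ⟨y, ε, hε, hb⟩

/-- A polynomial in the logarithms that vanishes almost surely has zero coefficients if the support
includes an open ball. -/
lemma log_coeff_eq_zero {ν : Measure (ℝ × ℝ × ℝ)}
    (hpos : ∀ᵐ z ∂ν, IsPosTriple z) {x : ℝ × ℝ × ℝ} {r : ℝ} (hr : 0 < r)
    (h : Metric.ball x r ⊆ ν.support) {b₀ b₁ b₂ b₃ b₄ : ℝ}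
    (h0 : ∀ᵐ z ∂ν, b₀ + b₁ * Real.log z.1 + b₂ * Real.log z.2.1
      + b₃ * Real.log z.1 * Real.log z.2.1 + b₄ * Real.log z.2.2 = 0) :
    b₀ = 0 ∧ b₁ = 0 ∧ b₂ = 0 ∧ b₃ = 0 ∧ b₄ = 0 := by
  obtain ⟨x, hx, hxs⟩ := exists_isPosTriple_eventually_mem_support hpos hr h
  have hz0 : ∀ z, IsPosTriple z → z ∈ ν.support → b₀ + b₁ * Real.log z.1 + b₂ * Real.log z.2.1
      + b₃ * Real.log z.1 * Real.log z.2.1 + b₄ * Real.log z.2.2 = 0 := fun z hz hzs => by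
    -- A nonzero value would persist on a neighbourhood, which has positive measure because `z` lies
    -- in the support.
    by_contra hne
    have h1 : ContinuousAt (fun z : ℝ × ℝ × ℝ => Real.log z.1) z :=
      ContinuousAt.log continuousAt_fst hz.1.ne'
    have h2 : ContinuousAt (fun z : ℝ × ℝ × ℝ => Real.log z.2.1) z :=
      ContinuousAt.log (by fun_prop) hz.2.1.ne'
    have h3 : ContinuousAt (fun z : ℝ × ℝ × ℝ => Real.log z.2.2) z :=
      ContinuousAt.log (by fun_prop) hz.2.2.ne'
    have hc : ContinuousAt (fun z : ℝ × ℝ × ℝ => b₀ + b₁ * Real.log z.1 + b₂ * Real.log z.2.1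
      + b₃ * Real.log z.1 * Real.log z.2.1 + b₄ * Real.log z.2.2) z := by fun_prop
    exact ((Measure.mem_support_iff_forall z).1 hzs _ (hc.eventually_ne hne)).ne' h0
  obtain ⟨ε, hε, hb⟩ := Metric.eventually_nhds_iff_ball.1 (hxs.and hx.eventually)
  have H : ∀ i j k : ℝ, |i| < ε → |j| < ε → |k| < ε →
      b₀ + b₁ * Real.log (x.1 + i) + b₂ * Real.log (x.2.1 + j)
      + b₃ * Real.log (x.1 + i) * Real.log (x.2.1 + j) + b₄ * Real.log (x.2.2 + k) = 0 := by
    intro i j k hi hj hk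
    have := hb (x.1 + i, x.2.1 + j, x.2.2 + k) (by
      rw [Metric.mem_ball, Prod.dist_eq, Prod.dist_eq]
      simp [hi, hj, hk])
    exact hz0 _ this.2 this.1
  have hL : ∀ u : ℝ, 0 < u → Real.log (u + 0) ≠ Real.log (u + ε / 2) := fun u hu =>
    (Real.log_lt_log (by linarith) (by linarith)).ne
  have e0 : |(0 : ℝ)| < ε := by simpa using hε
  have e1 : |ε / 2| < ε := by rw [abs_of_pos (by linarith)]; linarith
  have n1 := sub_ne_zero.2 (hL _ hx.1)
  have n2 := sub_ne_zero.2 (hL _ hx.2.1)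
  have n3 := sub_ne_zero.2 (hL _ hx.2.2)
  -- Five corners of a small box suffice: single differences isolate `b₄`, the mixed second
  -- difference isolates `b₃`, and then single differences give `b₁` and `b₂`.
  have H000 := H 0 0 0 e0 e0 e0
  have H001 := H 0 0 (ε / 2) e0 e0 e1
  have H010 := H 0 (ε / 2) 0 e0 e1 e0
  have H100 := H (ε / 2) 0 0 e1 e0 e0
  have H110 := H (ε / 2) (ε / 2) 0 e1 e1 e0
  generalize Real.log (x.1 + 0) = u at *
  generalize Real.log (x.1 + ε / 2) = u' at *
  generalize Real.log (x.2.1 + 0) = v at *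
  generalize Real.log (x.2.1 + ε / 2) = v' at *
  generalize Real.log (x.2.2 + 0) = w at *
  generalize Real.log (x.2.2 + ε / 2) = w' at *
  have c4 : b₄ = 0 := by
    have : b₄ * (w - w') = 0 := by linear_combination H000 - H001
    exact (mul_eq_zero.1 this).resolve_right n3
  have c3 : b₃ = 0 := by
    have : b₃ * ((u - u') * (v - v')) = 0 := by linear_combination H000 - H010 - H100 + H110
    exact (mul_eq_zero.1 this).resolve_right (mul_ne_zero n1 n2)
  subst c4 c3
  have c1 : b₁ = 0 := by
    have : b₁ * (u - u') = 0 := by linear_combination H000 - H100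
    exact (mul_eq_zero.1 this).resolve_right n1
  have c2 : b₂ = 0 := by
    have : b₂ * (v - v') = 0 := by linear_combination H000 - H010
    exact (mul_eq_zero.1 this).resolve_right n2
  subst c1 c2
  exact ⟨by linarith, rfl, rfl, rfl, rfl⟩

end Support

/-! ### Invariance of the model under changes of scale -/

section Reparametrization

variable {T : ℕ} {Ω : Type}

/-- The random variables of the model with parameters `p`, expressed in the scales of log skills and
log investment that belong to the parameters `q`. -/
def Primitives.reparam (L : Primitives T Ω) (p q : Params T) : Primitives T Ω where
  skill t ω := Real.exp ((p.muS t 0 - q.muS t 0) / q.lamS t 0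
    + p.lamS t 0 / q.lamS t 0 * L.logSkill t ω)
  inv t ω := Real.exp ((p.muI t 0 - q.muI t 0) / q.lamI t 0
    + p.lamI t 0 / q.lamI t 0 * L.logInv t ω)
  inc := L.inc
  err := L.err
  etaS t ω := p.lamS t.succ 0 / q.lamS t.succ 0 * L.etaS t ω
  etaI t ω := p.lamI t 0 / q.lamI t 0 * L.etaI t ω

variable (L : Primitives T Ω) (p : Params T) {q : Params T}

lemma Primitives.reparam_logSkill (t : Fin (T + 1)) (ω : Ω) :
    (L.reparam p q).logSkill t ω = (p.muS t 0 - q.muS t 0) / q.lamS t 0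
      + p.lamS t 0 / q.lamS t 0 * L.logSkill t ω :=
  Real.log_exp _

lemma Primitives.reparam_logInv (t : Fin T) (ω : Ω) :
    (L.reparam p q).logInv t ω = (p.muI t 0 - q.muI t 0) / q.lamI t 0
      + p.lamI t 0 / q.lamI t 0 * L.logInv t ω :=
  Real.log_exp _

lemma Primitives.measureS_reparam (hq : q.NonzeroLoadings) (t : Fin (T + 1)) (ω : Ω) :
    q.muS t 0 + q.lamS t 0 * (L.reparam p q).logSkill t ω =
      p.muS t 0 + p.lamS t 0 * L.logSkill t ω := by
  have := hq.1 t 0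
  rw [L.reparam_logSkill]
  field_simp
  ring

lemma Primitives.measureI_reparam (hq : q.NonzeroLoadings) (t : Fin T) (ω : Ω) :
    q.muI t 0 + q.lamI t 0 * (L.reparam p q).logInv t ω =
      p.muI t 0 + p.lamI t 0 * L.logInv t ω := by
  have := hq.2 t 0
  rw [L.reparam_logInv]
  field_simp
  ring

variable {p}

lemma obsLaw_reparam [MeasurableSpace Ω] (P : Measure Ω) (hp : p.NonzeroLoadings)
    (hq : q.NonzeroLoadings) (hpq : q.tilde = p.tilde) :
    obsLaw P (L.reparam p q) q = obsLaw P L p := by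
  unfold obsLaw
  refine congrArg (Measure.map · P) (funext fun ω => ?_)
  have hS : ∀ t m, (L.reparam p q).ZS q t m ω = L.ZS p t m ω := fun t m => by
    unfold Primitives.ZS
    rw [← Params.tilde_measureS hq, ← Params.tilde_measureS hp, L.measureS_reparam p hq, hpq]
    rfl
  have hI : ∀ t m, (L.reparam p q).ZI q t m ω = L.ZI p t m ω := fun t m => by
    unfold Primitives.ZI
    rw [← Params.tilde_measureI hq, ← Params.tilde_measureI hp, L.measureI_reparam p hq, hpq]
    rfl
  have hQ : (L.reparam p q).Q q ω = L.Q p ω := by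
    unfold Primitives.Q
    rw [← Params.tilde_outcome hq, ← Params.tilde_outcome hp, L.measureS_reparam p hq, hpq]
    rfl
  simp only [hS, hI, hQ]
  rfl

/-- The tower property passes to the smaller σ-algebra, for which `κ * g` is still measurable. An
inclusion is thus enough for the rescaled conditioning variables, with no need to show that they
generate the same σ-algebra. -/
lemma condExp_const_mul_eq_of_le {m m' m₀ : MeasurableSpace Ω} {P : @Measure Ω m₀}
    [IsFiniteMeasure P] (hm : m' ≤ m) (hm₀ : m ≤ m₀) {f g : Ω → ℝ} {κ : ℝ} (c : ℝ) {d : ℝ}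
    (hd : d ≠ 0) (hg : Measurable[m'] fun ω => d * g ω) (hi : Integrable g P)
    (h : P[f | m] =ᵐ[P] fun ω => κ * g ω) :
    P[fun ω => c * f ω | m'] =ᵐ[P] fun ω => c * κ / d * (d * g ω) := by
  have hη : Measurable[m'] fun ω => κ * g ω := by
    have h2 : (fun ω => κ * g ω) = fun ω => κ / d * (d * g ω) := by
      funext ω
      rw [← mul_assoc, div_mul_cancel₀ _ hd]
    rw [h2]
    exact hg.const_mul _
  have h0 : P[f | m'] =ᵐ[P] fun ω => κ * g ω := by
    refine (condExp_condExp_of_le hm hm₀).symm.trans ((condExp_congr_ae h).trans ?_)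
    rw [condExp_of_stronglyMeasurable (hm.trans hm₀) hη.stronglyMeasurable (hi.const_mul κ)]
  refine (condExp_smul c f _).trans ?_
  filter_upwards [h0] with ω hω
  rw [Pi.smul_apply, hω, smul_eq_mul, ← mul_assoc (c * κ / d), div_mul_cancel₀ _ hd, mul_assoc]

lemma condExp_const_mul_eq_zero_of_le {m m' m₀ : MeasurableSpace Ω} {P : @Measure Ω m₀}
    [IsFiniteMeasure P] (hm : m' ≤ m) (hm₀ : m ≤ m₀) {f : Ω → ℝ} (c : ℝ) (h : P[f | m] =ᵐ[P] 0) :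
    P[fun ω => c * f ω | m'] =ᵐ[P] 0 := by
  have := condExp_const_mul_eq_of_le (g := 0) (κ := 0) hm hm₀ c one_ne_zero
    (by simp) (integrable_zero _ _ _) (h.trans (by simp; rfl))
  exact this.trans (by simp; rfl)

lemma memLp_const_add_const_mul [MeasurableSpace Ω] {P : Measure Ω} [IsFiniteMeasure P] {X : Ω → ℝ}
    (hX : MemLp X 2 P) (c d : ℝ) : MemLp (fun ω => c + d * X ω) 2 P := by
  have h1 : MemLp (fun _ : Ω => c) 2 P := memLp_const c
  have h2 : MemLp (fun ω => d * X ω) 2 P := hX.const_mul d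
  exact h1.add h2

lemma comap_le_comap_of_comp {β β' : Type*} [mβ : MeasurableSpace β] [mβ' : MeasurableSpace β']
    {f : Ω → β} {φ : β → β'} (hφ : Measurable φ) :
    MeasurableSpace.comap (fun ω => φ (f ω)) mβ' ≤ MeasurableSpace.comap f mβ := by
  rw [show (fun ω => φ (f ω)) = φ ∘ f from rfl, ← MeasurableSpace.comap_comp]
  exact MeasurableSpace.comap_mono hφ.comap_le

variable {L} [MeasurableSpace Ω] [StandardBorelSpace Ω] {P : Measure Ω} [IsProbabilityMeasure P]

lemma Baseline.meas_inc (h : Baseline P L p) (t : Fin T) : Measurable (L.inc t) :=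
  measurable_pi_iff.1 h.meas_incVec t

lemma Baseline.ae_isPosTriple (h : Baseline P L p) (t : Fin T) :
    ∀ᵐ z ∂(P.map fun ω => (L.skill t.castSucc ω, L.inv t ω, L.inc t ω)), IsPosTriple z := by
  have := h.meas_skill t.castSucc
  have := h.meas_inv t
  have := h.meas_inc t
  have hm : MeasurableSet {z : ℝ × ℝ × ℝ | IsPosTriple z} := by
    refine (measurableSet_lt measurable_const measurable_fst).inter
      ((measurableSet_lt measurable_const measurable_snd.fst).inter
        (measurableSet_lt measurable_const measurable_snd.snd))
  rw [ae_map_iff (by fun_prop) hm]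
  filter_upwards [h.pos_skill t.castSucc, h.pos_inv t, h.pos_inc t] with ω h1 h2 h3
    using ⟨h1, h2, h3⟩

/-- Errors and incomes are untouched, covariances are multiplied by nonzero constants, and
conditional means pass to the σ-algebras of the rescaled variables. The structural equations carry
over because, in units of the first measures, both parameter vectors give the same equations. -/
theorem Baseline.reparam (h : Baseline P L p) (hq : q.NonzeroLoadings) (hpq : q.tilde = p.tilde) :
    Baseline P (L.reparam p q) q := by
  have hp := h.loadings
  have mS := h.meas_skill
  have mI := h.meas_inv
  have mY := h.meas_inc
  have mES := h.meas_etaS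
  have mEI := h.meas_etaI
  have mLS : ∀ t, Measurable (L.logSkill t) := fun t => (mS t).log
  have mLI : ∀ t, Measurable (L.logInv t) := fun t => (mI t).log
  have cS : ∀ t, p.lamS t 0 / q.lamS t 0 ≠ 0 := fun t => div_ne_zero (hp.1 t 0) (hq.1 t 0)
  have cI : ∀ t, p.lamI t 0 / q.lamI t 0 ≠ 0 := fun t => div_ne_zero (hp.2 t 0) (hq.2 t 0)
  have fS : ∀ t, (L.reparam p q).logSkill t = fun ω => (p.muS t 0 - q.muS t 0) / q.lamS t 0
      + p.lamS t 0 / q.lamS t 0 * L.logSkill t ω := fun t => funext (L.reparam_logSkill p t)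
  have fI : ∀ t, (L.reparam p q).logInv t = fun ω => (p.muI t 0 - q.muI t 0) / q.lamI t 0
      + p.lamI t 0 / q.lamI t 0 * L.logInv t ω := fun t => funext (L.reparam_logInv p t)
  have mS' : ∀ t, Measurable ((L.reparam p q).skill t) := fun t => by
    unfold Primitives.reparam; fun_prop
  have mI' : ∀ t, Measurable ((L.reparam p q).inv t) := fun t => by
    unfold Primitives.reparam; fun_prop
  have mES' : ∀ t, Measurable ((L.reparam p q).etaS t) := fun t => by
    unfold Primitives.reparam; fun_prop
  have mEI' : ∀ t, Measurable ((L.reparam p q).etaI t) := fun t => by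
    unfold Primitives.reparam; fun_prop
  have m2 : ∀ t, Measurable fun ω => (L.skill t.castSucc ω, L.inc t ω) := fun t =>
    (mS t.castSucc).prodMk (mY t)
  have m3 : ∀ t, Measurable fun ω => (L.skill t.castSucc ω, L.inv t ω, L.inc t ω) := fun t =>
    (mS t.castSucc).prodMk ((mI t).prodMk (mY t))
  have m3' : ∀ t, Measurable fun ω => (L.skill t.castSucc ω, L.etaI t ω, L.inc t ω) := fun t =>
    (mS t.castSucc).prodMk ((mEI t).prodMk (mY t))
  have le2 : ∀ t, MeasurableSpace.comap (fun ω => ((L.reparam p q).skill t.castSucc ω,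
      (L.reparam p q).inc t ω)) inferInstance ≤
      MeasurableSpace.comap (fun ω => (L.skill t.castSucc ω, L.inc t ω))
        inferInstance := fun t => by
    have hφ : Measurable fun z : ℝ × ℝ =>
      (Real.exp ((p.muS t.castSucc 0 - q.muS t.castSucc 0) / q.lamS t.castSucc 0
        + p.lamS t.castSucc 0 / q.lamS t.castSucc 0 * Real.log z.1), z.2) := by fun_prop
    exact comap_le_comap_of_comp (f := fun ω => (L.skill t.castSucc ω, L.inc t ω)) hφ
  have le3 : ∀ t, MeasurableSpace.comap (fun ω => ((L.reparam p q).skill t.castSucc ω,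
      (L.reparam p q).etaI t ω, (L.reparam p q).inc t ω)) inferInstance ≤
      MeasurableSpace.comap (fun ω => (L.skill t.castSucc ω, L.etaI t ω, L.inc t ω))
        inferInstance := fun t => by
    have hφ : Measurable fun z : ℝ × ℝ × ℝ =>
      (Real.exp ((p.muS t.castSucc 0 - q.muS t.castSucc 0) / q.lamS t.castSucc 0
        + p.lamS t.castSucc 0 / q.lamS t.castSucc 0 * Real.log z.1),
        p.lamI t 0 / q.lamI t 0 * z.2.1, z.2.2) := by fun_prop
    exact comap_le_comap_of_comp (f := fun ω => (L.skill t.castSucc ω, L.etaI t ω, L.inc t ω)) hφ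
  have mlS := h.moment_skill
  have mlI := h.moment_inv
  have iS := fun t => (mlS t).integrable one_le_two
  have iI := fun t => (mlI t).integrable one_le_two
  have b2 : ∀ t, q.lamI t 0 * q.beta2 t = p.lamI t 0 * p.beta2 t := fun t =>
    congrFun (congrArg Params.beta2 hpq) t
  exact
  { meas_skill := mS'
    meas_inv := mI'
    meas_incVec := h.meas_incVec
    meas_err := h.meas_err
    meas_etaS := mES'
    meas_etaI := mEI'
    pos_skill := fun t => ae_of_all _ fun ω => Real.exp_pos _
    pos_inv := fun t => ae_of_all _ fun ω => Real.exp_pos _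
    pos_inc := h.pos_inc
    production := fun t => by
      filter_upwards [h.production t] with ω hω
      have e := Params.tilde_production hq t ((L.reparam p q).logSkill t.castSucc ω)
        ((L.reparam p q).logInv t ω)
      rw [L.measureS_reparam p hq, L.measureI_reparam p hq, hpq, Params.tilde_production hp] at e
      have e' := L.measureS_reparam p hq t.succ ω
      rw [hω] at e'
      have hn := hq.1 t.succ 0
      -- Multiplying by the loading turns the claim into an identity in units of the first measure,
      -- where equality of the rescaled parameters applies.
      refine mul_left_cancel₀ hn ?_
      have : q.lamS t.succ 0 * (L.reparam p q).etaS t ω = p.lamS t.succ 0 * L.etaS t ω := by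
        simp only [Primitives.reparam]
        field_simp
      linear_combination e' + e - this
    investment := fun t => by
      filter_upwards [h.investment t] with ω hω
      have e := Params.tilde_investment hq t ((L.reparam p q).logSkill t.castSucc ω)
        (L.logInc t ω)
      rw [L.measureS_reparam p hq, hpq, Params.tilde_investment hp] at e
      have e' := L.measureI_reparam p hq t ω
      rw [hω] at e'
      have hn := hq.2 t 0
      refine mul_left_cancel₀ hn ?_
      have : q.lamI t 0 * (L.reparam p q).etaI t ω = p.lamI t 0 * L.etaI t ω := by
        simp only [Primitives.reparam]
        field_simp
      change _ = q.lamI t 0 * (_ + q.beta2 t * L.logInc t ω + _)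
      linear_combination e' + e - this
    relevance := fun t h0 => mul_ne_zero (hp.2 t 0) (h.relevance t) (by rw [← b2, h0, mul_zero])
    err_iIndep := h.err_iIndep
    err_indep_latent := by
      have hφ : Measurable fun z : (Fin (T + 1) → ℝ) × (Fin T → ℝ) =>
          ((fun t => Real.exp ((p.muS t 0 - q.muS t 0) / q.lamS t 0
            + p.lamS t 0 / q.lamS t 0 * Real.log (z.1 t)),
          fun t => Real.exp ((p.muI t 0 - q.muI t 0) / q.lamI t 0
            + p.lamI t 0 / q.lamI t 0 * Real.log (z.2 t))) :
            (Fin (T + 1) → ℝ) × (Fin T → ℝ)) := by fun_prop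
      exact h.err_indep_latent.comp measurable_id hφ
    moment_skill := fun t => by
      rw [fS]
      exact memLp_const_add_const_mul (mlS t) _ _
    moment_inv := fun t => by
      rw [fI]
      exact memLp_const_add_const_mul (mlI t) _ _
    moment_inc := h.moment_inc
    moment_err := h.moment_err
    moment_etaS := fun t => (h.moment_etaS t).const_mul _
    moment_etaI := fun t => (h.moment_etaI t).const_mul _
    err_mean := h.err_mean
    loadings := hq
    cov_skill := fun t => by
      refine (h.cov_skill t).imp (fun ⟨s, hs⟩ => ⟨s, ?_⟩) (fun ⟨s, hst, hs⟩ => ⟨s, hst, ?_⟩)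
      · rw [fS, fI, covariance_const_add_left ((iS _).const_mul _),
          covariance_const_add_right ((iI _).const_mul _), covariance_const_mul_left,
          covariance_const_mul_right]
        exact mul_ne_zero (cS _) (mul_ne_zero (cI _) hs)
      · rw [fS, fS, covariance_const_add_left ((iS _).const_mul _),
          covariance_const_add_right ((iS _).const_mul _), covariance_const_mul_left,
          covariance_const_mul_right]
        exact mul_ne_zero (cS _) (mul_ne_zero (cS _) hs)
    cov_inv := fun t => by
      refine (h.cov_inv t).imp (fun ⟨s, hs⟩ => ⟨s, ?_⟩) (fun ⟨s, hst, hs⟩ => ⟨s, hst, ?_⟩)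
      · rw [fS, fI, covariance_const_add_left ((iI _).const_mul _),
          covariance_const_add_right ((iS _).const_mul _), covariance_const_mul_left,
          covariance_const_mul_right]
        exact mul_ne_zero (cI _) (mul_ne_zero (cS _) hs)
      · rw [fI, fI, covariance_const_add_left ((iI _).const_mul _),
          covariance_const_add_right ((iI _).const_mul _), covariance_const_mul_left,
          covariance_const_mul_right]
        exact mul_ne_zero (cI _) (mul_ne_zero (cI _) hs)
    err_charFun := h.err_charFun
    support_ball := fun t => by
      obtain ⟨x, r, hr, hb⟩ := h.support_ball t
      have := exists_ball_subset_support_map_logAffine (h.ae_isPosTriple t) hr hb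
        ((p.muS t.castSucc 0 - q.muS t.castSucc 0) / q.lamS t.castSucc 0)
        ((p.muI t 0 - q.muI t 0) / q.lamI t 0) (cS t.castSucc) (cI t)
      rwa [Measure.map_map (measurable_logAffine _ _ _ _) (m3 t)] at this
    etaS_mean := fun t =>
      condExp_const_mul_eq_zero_of_le (le2 t) (m2 t).comap_le _ (h.etaS_mean t)
    etaI_mean := fun t =>
      condExp_const_mul_eq_zero_of_le (le2 t) (m2 t).comap_le _ (h.etaI_mean t)
    control := fun t => by
      obtain ⟨κ, hκ⟩ := h.control t
      refine ⟨_, condExp_const_mul_eq_of_le (le3 t) (m3' t).comap_le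
        (p.lamS t.succ 0 / q.lamS t.succ 0) (cI t) ?_
        ((h.moment_etaI t).integrable one_le_two) hκ⟩
      exact (measurable_fst.comp measurable_snd).comp (comap_measurable _) }

end Reparametrization

/-! ### Uniform indexing of latent variables and their measures -/

section Indexing

variable {T : ℕ} {Ω : Type}

/-- Index set of the latent variables: skills and investment. -/
abbrev LatIdx (T : ℕ) : Type := Fin (T + 1) ⊕ Fin T

/-- The logarithms of all latent variables. -/
def Primitives.logLatent (L : Primitives T Ω) : LatIdx T → Ω → ℝ := Sum.elim L.logSkill L.logInv

/-- The latent variable that an observed variable measures. -/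
def latIdx : ErrIdx T → LatIdx T :=
  Sum.elim (fun i => Sum.inl i.1) (Sum.elim (fun i => Sum.inr i.1) fun _ => Sum.inl (Fin.last T))

/-- The index of the `m`-th measure of a latent variable. -/
def measureIdx : LatIdx T × Fin 2 → ErrIdx T
  | (Sum.inl t, m) => Sum.inl (t, m)
  | (Sum.inr t, m) => Sum.inr (Sum.inl (t, m))

lemma latIdx_measureIdx (i : LatIdx T) (m : Fin 2) : latIdx (measureIdx (i, m)) = i := by
  rcases i with t | t <;> rfl

lemma measureIdx_injective : Function.Injective (measureIdx (T := T)) := by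
  rintro ⟨s | s, m⟩ ⟨t | t, n⟩ h <;> simp_all [measureIdx]

/-- The intercept of an observed variable. -/
def Params.intercept (p : Params T) : ErrIdx T → ℝ :=
  Sum.elim (fun i => p.muS i.1 i.2) (Sum.elim (fun i => p.muI i.1 i.2) fun _ => p.rho0)

/-- The loading of an observed variable. -/
def Params.loading (p : Params T) : ErrIdx T → ℝ :=
  Sum.elim (fun i => p.lamS i.1 i.2) (Sum.elim (fun i => p.lamI i.1 i.2) fun _ => p.rho1)

/-- The observed variables other than income. -/
def Primitives.observed (L : Primitives T Ω) (p : Params T) (i : ErrIdx T) (ω : Ω) : ℝ :=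
  p.intercept i + p.loading i * L.logLatent (latIdx i) ω + L.err i ω

/-- Rearrangement of the observed variables. -/
def obsCoord (z : Obs T) : (Fin T → ℝ) × (ErrIdx T → ℝ) :=
  (z.2.2.1, Sum.elim (fun i => z.1 i.1 i.2) (Sum.elim (fun i => z.2.1 i.1 i.2) fun _ => z.2.2.2))

lemma measurable_obsCoord : Measurable (obsCoord (T := T)) := by
  refine Measurable.prodMk (by fun_prop) (measurable_pi_lambda _ fun i => ?_)
  rcases i with i | i | i <;> simp only [Sum.elim_inl, Sum.elim_inr] <;> fun_prop

lemma Params.IsNormalized.intercept {p : Params T} (hp : p.IsNormalized) (i : LatIdx T) :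
    p.intercept (measureIdx (i, 0)) = 0 := by
  rcases i with t | t
  exacts [hp.muS t, hp.muI t]

lemma Params.IsNormalized.loading {p : Params T} (hp : p.IsNormalized) (i : LatIdx T) :
    p.loading (measureIdx (i, 0)) = 1 := by
  rcases i with t | t
  exacts [hp.lamS t, hp.lamI t]

lemma Params.NonzeroLoadings.loading_ne_zero {p : Params T} (hp : p.NonzeroLoadings)
    (i : LatIdx T × Fin 2) : p.loading (measureIdx i) ≠ 0 := by
  rcases i with ⟨t | t, m⟩
  exacts [hp.1 t m, hp.2 t m]

end Indexing

/-! ### First and second moments of the observed variables -/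

section Moments

variable {T : ℕ} {Ω : Type} [MeasurableSpace Ω] [StandardBorelSpace Ω] {P : Measure Ω}
  [IsProbabilityMeasure P] {L : Primitives T Ω} {p : Params T}

lemma Baseline.measurable_logLatent (h : Baseline P L p) (i : LatIdx T) :
    Measurable (L.logLatent i) := by
  rcases i with t | t
  exacts [(h.meas_skill t).log, (h.meas_inv t).log]

lemma Baseline.measurable_observed (h : Baseline P L p) (i : ErrIdx T) :
    Measurable (L.observed p i) := by
  have := h.measurable_logLatent
  have := h.meas_err
  unfold Primitives.observed
  fun_prop

lemma Baseline.memLp_logLatent (h : Baseline P L p) (i : LatIdx T) :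
    MemLp (L.logLatent i) 2 P := by
  rcases i with t | t
  exacts [h.moment_skill t, h.moment_inv t]

lemma Baseline.map_obsCoord_obsLaw (h : Baseline P L p) :
    (obsLaw P L p).map obsCoord = P.map fun ω => (L.incVec ω, fun i => L.observed p i ω) := by
  have hS : ∀ t m, Measurable (L.ZS p t m) := fun t m => h.measurable_observed (Sum.inl (t, m))
  have hI : ∀ t m, Measurable (L.ZI p t m) := fun t m =>
    h.measurable_observed (Sum.inr (Sum.inl (t, m)))
  have hQ : Measurable (L.Q p) := h.measurable_observed (Sum.inr (Sum.inr ()))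
  have hY := h.meas_incVec
  rw [obsLaw, Measure.map_map measurable_obsCoord (by fun_prop)]
  refine congrArg (Measure.map · P) (funext fun ω => Prod.ext rfl (funext fun i => ?_))
  rcases i with i | i | i <;> rfl

lemma Baseline.condIndepFun_errVec_logLatent (h : Baseline P L p) :
    CondIndepFun (MeasurableSpace.comap L.incVec inferInstance) h.meas_incVec.comap_le
      L.errVec (fun ω i => L.logLatent i ω) P := by
  have hψ : Measurable fun (z : (Fin (T + 1) → ℝ) × (Fin T → ℝ)) (i : LatIdx T) =>
      Sum.elim (fun t => Real.log (z.1 t)) (fun t => Real.log (z.2 t)) i := by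
    refine measurable_pi_lambda _ fun i => ?_
    rcases i with t | t <;> simp only [Sum.elim_inl, Sum.elim_inr] <;> fun_prop
  have := h.err_indep_latent.comp measurable_id hψ
  convert! this using 1
  funext ω i
  rcases i with t | t <;> rfl

lemma Baseline.measurementErrors [Nonempty Ω] (h : Baseline P L p) :
    MeasurementErrors P L.incVec L.logLatent (fun i => L.err (measureIdx i)) where
  meas_cond := h.meas_incVec
  meas_latent := h.measurable_logLatent
  meas_err i := h.meas_err _
  iIndep := h.err_iIndep.precomp measureIdx_injective
  indep := by
    have hφ : Measurable fun (x : ErrIdx T → ℝ) (i : LatIdx T × Fin 2) => x (measureIdx i) := by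
      fun_prop
    exact h.condIndepFun_errVec_logLatent.comp hφ measurable_id
  integrable_latent i := (h.memLp_logLatent i).integrable one_le_two
  integrable_err i := (h.moment_err _).integrable one_le_two
  mean i := h.err_mean _
  regular i := h.err_charFun _

lemma integral_eq_zero_of_ae_integral_condDistrib [Nonempty Ω] {γ : Type*} [MeasurableSpace γ]
    {k : Ω → γ} (hk : Measurable k) {f : Ω → ℝ} (hi : Integrable f P)
    (h : ∀ᵐ y ∂P.map k, ∫ ω, f ω ∂(condDistrib id k P y) = 0) : ∫ ω, f ω ∂P = 0 := by
  rw [← integral_condExp hk.comap_le,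
    integral_congr_ae (condExp_ae_eq_integral_condDistrib_id hk hi)]
  exact integral_eq_zero_of_ae (ae_of_ae_map hk.aemeasurable h)

/-- A variable with conditional mean zero is uncorrelated with any variable from which it is
conditionally independent. -/
lemma covariance_eq_zero_of_condIndepFun [Nonempty Ω] {γ : Type*} [MeasurableSpace γ]
    {k : Ω → γ} (hk : Measurable k) {f g : Ω → ℝ} (hf : Measurable f) (hg : Measurable g)
    (lf : MemLp f 2 P) (lg : MemLp g 2 P)
    (h : CondIndepFun (MeasurableSpace.comap k inferInstance) hk.comap_le f g P)
    (h0 : P[f | MeasurableSpace.comap k inferInstance] =ᵐ[P] 0) :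
    cov[f, g; P] = 0 ∧ ∫ ω, f ω ∂P = 0 := by
  have hi := lf.integrable one_le_two
  have h1 := ae_integral_condDistrib_eq_zero hk hf hi h0
  have h2 := integral_eq_zero_of_ae_integral_condDistrib hk hi h1
  have h3 := integral_eq_zero_of_ae_integral_condDistrib hk (lf.integrable_mul lg) (by
    filter_upwards [CondIndepFun.ae_indepFun_condDistrib hk hf hg h, h1] with y hy hy1
    rw [hy.integral_mul_eq_mul_integral hf.aestronglyMeasurable hg.aestronglyMeasurable, hy1,
      zero_mul])
  refine ⟨?_, h2⟩
  rw [covariance_eq_sub lf lg, h2, zero_mul, sub_zero]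
  exact h3

lemma Baseline.covariance_err_logLatent [Nonempty Ω] (h : Baseline P L p) (i : ErrIdx T)
    (j : LatIdx T) : cov[L.err i, L.logLatent j; P] = 0 :=
  (covariance_eq_zero_of_condIndepFun h.meas_incVec (h.meas_err i) (h.measurable_logLatent j)
    (h.moment_err i) (h.memLp_logLatent j)
    (h.condIndepFun_errVec_logLatent.comp (measurable_pi_apply i) (measurable_pi_apply j))
    (h.err_mean i)).1

lemma Baseline.covariance_err_err [Nonempty Ω] (h : Baseline P L p) {i j : ErrIdx T}
    (hij : i ≠ j) : cov[L.err i, L.err j; P] = 0 :=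
  (covariance_eq_zero_of_condIndepFun h.meas_incVec (h.meas_err i) (h.meas_err j)
    (h.moment_err i) (h.moment_err j) (h.err_iIndep.condIndepFun hij) (h.err_mean i)).1

lemma Baseline.integral_err [Nonempty Ω] (h : Baseline P L p) (i : ErrIdx T) :
    ∫ ω, L.err i ω ∂P = 0 :=
  integral_eq_zero_of_ae_integral_condDistrib h.meas_incVec
    ((h.moment_err i).integrable one_le_two)
    (ae_integral_condDistrib_eq_zero h.meas_incVec (h.meas_err i)
      ((h.moment_err i).integrable one_le_two) (h.err_mean i))

/-- Distinct errors are uncorrelated with each other and with all latent variables, so only the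
latent parts contribute. -/
lemma Baseline.covariance_observed [Nonempty Ω] (h : Baseline P L p) {i j : ErrIdx T}
    (hij : i ≠ j) : cov[L.observed p i, L.observed p j; P] =
      p.loading i * p.loading j * cov[L.logLatent (latIdx i), L.logLatent (latIdx j); P] := by
  have l1 := fun i => memLp_const_add_const_mul (h.memLp_logLatent (latIdx i)) (p.intercept i)
    (p.loading i)
  have l2 := h.moment_err
  have l3 := fun i => (h.memLp_logLatent (latIdx i)).integrable one_le_two
  have e : ∀ i, L.observed p i =
      (fun ω => p.intercept i + p.loading i * L.logLatent (latIdx i) ω) + L.err i := fun i => rfl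
  rw [e, e, covariance_add_left (l1 i) (l2 i) ((l1 j).add (l2 j)),
    covariance_add_right (l1 i) (l1 j) (l2 j), covariance_add_right (l2 i) (l1 j) (l2 j),
    h.covariance_err_err hij, covariance_const_add_left ((l3 i).const_mul _),
    covariance_const_add_left ((l3 i).const_mul _),
    covariance_const_add_right ((l3 j).const_mul _),
    covariance_const_add_right ((l3 j).const_mul _), covariance_const_mul_left,
    covariance_const_mul_left, covariance_const_mul_right, covariance_const_mul_right,
    covariance_comm (L.logLatent (latIdx i)) (L.err j), h.covariance_err_logLatent,
    h.covariance_err_logLatent]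
  ring

lemma Baseline.integral_observed [Nonempty Ω] (h : Baseline P L p) (i : ErrIdx T) :
    ∫ ω, L.observed p i ω ∂P =
      p.intercept i + p.loading i * ∫ ω, L.logLatent (latIdx i) ω ∂P := by
  have l3 := (h.memLp_logLatent (latIdx i)).integrable one_le_two
  have l1 := (memLp_const_add_const_mul (h.memLp_logLatent (latIdx i)) (p.intercept i)
    (p.loading i)).integrable one_le_two
  unfold Primitives.observed
  rw [integral_add l1 ((h.moment_err i).integrable one_le_two), h.integral_err, add_zero,
    integral_add (integrable_const _) (l3.const_mul _), integral_const_mul]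
  simp

lemma Baseline.exists_covariance_ne_zero (h : Baseline P L p) (i : LatIdx T) :
    ∃ j, j ≠ i ∧ cov[L.logLatent i, L.logLatent j; P] ≠ 0 := by
  rcases i with t | t
  · rcases h.cov_skill t with ⟨s, hs⟩ | ⟨s, hst, hs⟩
    · exact ⟨Sum.inr s, by simp, hs⟩
    · exact ⟨Sum.inl s, by simpa using hst, hs⟩
  · rcases h.cov_inv t with ⟨s, hs⟩ | ⟨s, hst, hs⟩
    · exact ⟨Sum.inl s, by simp, hs⟩
    · exact ⟨Sum.inr s, by simpa using hst, hs⟩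

end Moments

/-! ### Identification of the measurement system and of the latent law -/

section Identification

variable {T : ℕ} {Ω Ω' : Type} [MeasurableSpace Ω] [StandardBorelSpace Ω] {P : Measure Ω}
  [IsProbabilityMeasure P] {L : Primitives T Ω} {p : Params T}
  [MeasurableSpace Ω'] [StandardBorelSpace Ω'] {P' : Measure Ω'}
  [IsProbabilityMeasure P'] {L' : Primitives T Ω'} {p' : Params T}

/-- The measurement system is identified from first and second moments. -/
lemma Baseline.measurement_eq [Nonempty Ω] [Nonempty Ω'] (h : Baseline P L p)
    (h' : Baseline P' L' p') (hp : p.IsNormalized) (hp' : p'.IsNormalized)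
    (hlaw : P.map (fun ω => (L.incVec ω, fun i => L.observed p i ω)) =
      P'.map fun ω => (L'.incVec ω, fun i => L'.observed p' i ω)) (i : ErrIdx T) :
    p.loading i = p'.loading i ∧ p.intercept i = p'.intercept i := by
  have hm : Measurable fun ω => (L.incVec ω, fun i => L.observed p i ω) :=
    h.meas_incVec.prodMk (measurable_pi_lambda _ h.measurable_observed)
  have hm' : Measurable fun ω => (L'.incVec ω, fun i => L'.observed p' i ω) :=
    h'.meas_incVec.prodMk (measurable_pi_lambda _ h'.measurable_observed)
  have hc : ∀ i j, cov[L.observed p i, L.observed p j; P] =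
      cov[L'.observed p' i, L'.observed p' j; P'] := fun i j => by
    have e1 := covariance_map (μ := P) (X := fun z : (Fin T → ℝ) × (ErrIdx T → ℝ) => z.2 i)
      (Y := fun z => z.2 j) (Measurable.aestronglyMeasurable (by fun_prop))
      (Measurable.aestronglyMeasurable (by fun_prop)) hm.aemeasurable
    have e2 := covariance_map (μ := P') (X := fun z : (Fin T → ℝ) × (ErrIdx T → ℝ) => z.2 i)
      (Y := fun z => z.2 j) (Measurable.aestronglyMeasurable (by fun_prop))
      (Measurable.aestronglyMeasurable (by fun_prop)) hm'.aemeasurable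
    rw [hlaw] at e1
    exact e1.symm.trans e2
  have hE : ∀ i, ∫ ω, L.observed p i ω ∂P = ∫ ω, L'.observed p' i ω ∂P' := fun i => by
    have e1 := integral_map (μ := P) hm.aemeasurable
      (f := fun z : (Fin T → ℝ) × (ErrIdx T → ℝ) => z.2 i)
      (Measurable.aestronglyMeasurable (by fun_prop))
    have e2 := integral_map (μ := P') hm'.aemeasurable
      (f := fun z : (Fin T → ℝ) × (ErrIdx T → ℝ) => z.2 i)
      (Measurable.aestronglyMeasurable (by fun_prop))
    rw [hlaw] at e1
    exact e1.symm.trans e2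
  -- The first measure of a correlated latent variable `k` acts as an instrument. Paired with the
  -- first measure of `latIdx i` it reveals the latent covariance, and paired with measure `i` it
  -- reveals that covariance times the loading.
  obtain ⟨k, hk, hcov⟩ := h.exists_covariance_ne_zero (latIdx i)
  have ne : ∀ j, latIdx j = latIdx i → j ≠ measureIdx (k, 0) := fun j hj hjk => by
    rw [hjk, latIdx_measureIdx] at hj
    exact hk hj
  have c1 := hc i (measureIdx (k, 0))
  have c2 := hc (measureIdx (latIdx i, 0)) (measureIdx (k, 0))
  rw [h.covariance_observed (ne _ rfl), h'.covariance_observed (ne _ rfl)] at c1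
  rw [h.covariance_observed (ne _ (latIdx_measureIdx _ _)),
    h'.covariance_observed (ne _ (latIdx_measureIdx _ _))] at c2
  simp only [latIdx_measureIdx, hp.loading, hp'.loading, one_mul, mul_one] at c1 c2
  rw [← c2] at c1
  have hl := mul_right_cancel₀ hcov c1
  refine ⟨hl, ?_⟩
  have e1 := hE i
  have e2 := hE (measureIdx (latIdx i, 0))
  rw [h.integral_observed, h'.integral_observed] at e1 e2
  simp only [latIdx_measureIdx, hp.loading, hp'.loading, hp.intercept, hp'.intercept, zero_add,
    one_mul] at e2
  rw [hl, e2] at e1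
  exact add_right_cancel e1

/-- The joint law of the latent variables and incomes is identified. -/
lemma Baseline.map_logLatent_eq [Nonempty Ω] [Nonempty Ω'] (h : Baseline P L p)
    (h' : Baseline P' L' p') (hp : p.IsNormalized) (hp' : p'.IsNormalized)
    (hlaw : P.map (fun ω => (L.incVec ω, fun i => L.observed p i ω)) =
      P'.map fun ω => (L'.incVec ω, fun i => L'.observed p' i ω)) :
    P.map (fun ω => (L.incVec ω, fun i => L.logLatent i ω)) =
      P'.map fun ω => (L'.incVec ω, fun i => L'.logLatent i ω) := by
  have hM := h.measurement_eq h' hp hp' hlaw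
  have hm : Measurable fun ω => (L.incVec ω, fun i => L.observed p i ω) :=
    h.meas_incVec.prodMk (measurable_pi_lambda _ h.measurable_observed)
  have hm' : Measurable fun ω => (L'.incVec ω, fun i => L'.observed p' i ω) :=
    h'.meas_incVec.prodMk (measurable_pi_lambda _ h'.measurable_observed)
  refine h.measurementErrors.map_latent_eq h'.measurementErrors
    (c := fun i => p.intercept (measureIdx (i, 1))) (l := fun i => p.loading (measureIdx (i, 1)))
    (fun i => h.loadings.loading_ne_zero _) ?_
  have hφ : Measurable fun z : (Fin T → ℝ) × (ErrIdx T → ℝ) =>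
      (z.1, fun i : LatIdx T => (z.2 (measureIdx (i, 0)), z.2 (measureIdx (i, 1)))) := by fun_prop
  have := congrArg (Measure.map fun z : (Fin T → ℝ) × (ErrIdx T → ℝ) =>
      (z.1, fun i : LatIdx T => (z.2 (measureIdx (i, 0)), z.2 (measureIdx (i, 1))))) hlaw
  rw [Measure.map_map hφ hm, Measure.map_map hφ hm'] at this
  simpa only [Function.comp_def, Primitives.observed, latIdx_measureIdx, hp.loading, hp'.loading,
    hp.intercept, hp'.intercept, zero_add, one_mul, (hM _).1, (hM _).2] using this

end Identification

/-! ### Comparison of regression functions -/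

section Regression

/-- Two regressions with the same joint law of regressand and regressors have residuals that agree
almost surely. -/
lemma ae_eq_zero_of_residuals {Ω Ω' E F : Type*} [MeasurableSpace Ω] [MeasurableSpace Ω']
    [MeasurableSpace E] [MeasurableSpace F] {P : Measure Ω} {P' : Measure Ω'} [IsFiniteMeasure P]
    {V : Ω → E} {V' : Ω' → E} (hV : Measurable V) (hV' : Measurable V')
    (hlaw : P.map V = P'.map V') {q q' : E → ℝ} {r : E → F} {d : F → ℝ} (hq : Measurable q)
    (hq' : Measurable q') (hr : Measurable r) (hd : Measurable d)
    (iq : Integrable (fun ω => q (V ω)) P) (iq' : Integrable (fun ω => q' (V' ω)) P')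
    (e : ∀ z, q z - q' z = d (r z))
    (h : ∀ A, MeasurableSet A → ∫ ω in {ω | r (V ω) ∈ A}, q (V ω) ∂P = 0)
    (h' : ∀ A, MeasurableSet A → ∫ ω in {ω | r (V' ω) ∈ A}, q' (V' ω) ∂P' = 0) :
    ∀ᵐ ω ∂P, d (r (V ω)) = 0 := by
  have j : Integrable q (P.map V) := (integrable_map_measure hq.aestronglyMeasurable
    hV.aemeasurable).2 iq
  have j' : Integrable q' (P.map V) := hlaw ▸ (integrable_map_measure hq'.aestronglyMeasurable
    hV'.aemeasurable).2 iq'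
  have jd : Integrable d ((P.map V).map r) := by
    refine (integrable_map_measure hd.aestronglyMeasurable hr.aemeasurable).2 ?_
    exact (j.sub j').congr (ae_of_all _ e)
  have key : d =ᵐ[(P.map V).map r] 0 := by
    refine jd.ae_eq_zero_of_forall_setIntegral_eq_zero fun A hA _ => ?_
    have k : ∫ z in r ⁻¹' A, q z ∂(P.map V) = 0 := by
      rw [setIntegral_map (hr hA) hq.aestronglyMeasurable hV.aemeasurable]
      exact h A hA
    have k' : ∫ z in r ⁻¹' A, q' z ∂(P.map V) = 0 := by
      rw [hlaw, setIntegral_map (hr hA) hq'.aestronglyMeasurable hV'.aemeasurable]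
      exact h' A hA
    rw [setIntegral_map hA hd.aestronglyMeasurable hr.aemeasurable]
    simp_rw [← e]
    rw [integral_sub j.integrableOn j'.integrableOn, k, k', sub_zero]
  exact ae_of_ae_map hV.aemeasurable (ae_of_ae_map hr.aemeasurable key)

lemma setIntegral_sub_eq_zero_of_condExp {Ω : Type*} {m m₀ : MeasurableSpace Ω} {P : Measure Ω}
    [IsFiniteMeasure P] (hm : m ≤ m₀) {f g : Ω → ℝ} (hf : Integrable f P) (hg : Integrable g P)
    (h : P[f | m] =ᵐ[P] g) {S : Set Ω} (hS : MeasurableSet[m] S) :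
    ∫ ω in S, (f ω - g ω) ∂P = 0 := by
  rw [integral_sub hf.integrableOn hg.integrableOn, ← setIntegral_condExp hm hf hS,
    setIntegral_congr_ae (hm S hS) (h.mono fun ω hω _ => hω), sub_self]

end Regression

/-! ### Identification of the structural equations and conclusion -/

section Equations

variable {T : ℕ} {Ω : Type} [MeasurableSpace Ω] [StandardBorelSpace Ω] {P : Measure Ω}
  [IsProbabilityMeasure P] {L : Primitives T Ω} {p : Params T}

lemma Baseline.log_coeff_eq_zero (h : Baseline P L p) (t : Fin T) {b₀ b₁ b₂ b₃ b₄ : ℝ}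
    (h0 : ∀ᵐ ω ∂P, b₀ + b₁ * L.logSkill t.castSucc ω + b₂ * L.logInv t ω
      + b₃ * L.logSkill t.castSucc ω * L.logInv t ω + b₄ * L.logInc t ω = 0) :
    b₀ = 0 ∧ b₁ = 0 ∧ b₂ = 0 ∧ b₃ = 0 ∧ b₄ = 0 := by
  obtain ⟨x, r, hr, hb⟩ := h.support_ball t
  refine SkillFormation.log_coeff_eq_zero (h.ae_isPosTriple t) hr hb ?_
  have m3 : Measurable fun ω => (L.skill t.castSucc ω, L.inv t ω, L.inc t ω) :=
    (h.meas_skill _).prodMk ((h.meas_inv t).prodMk (h.meas_inc t))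
  rw [ae_map_iff m3.aemeasurable (measurableSet_eq_fun (by fun_prop) measurable_const)]
  exact h0

/-- The residual of the investment equation. -/
def Params.resI (p : Params T) (t : Fin T) (z : (Fin T → ℝ) × (LatIdx T → ℝ)) : ℝ :=
  z.2 (Sum.inr t) -
    (p.beta0 t + p.beta1 t * z.2 (Sum.inl t.castSucc) + p.beta2 t * Real.log (z.1 t))

/-- The residual of the production function with control function `κ * resI`. -/
def Params.resS (p : Params T) (t : Fin T) (κ : ℝ) (z : (Fin T → ℝ) × (LatIdx T → ℝ)) : ℝ :=
  z.2 (Sum.inl t.succ) - (p.a t + p.gam1 t * z.2 (Sum.inl t.castSucc) + p.gam2 t * z.2 (Sum.inr t)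
    + p.gam3 t * z.2 (Sum.inl t.castSucc) * z.2 (Sum.inr t)) - κ * p.resI t z

lemma Params.measurable_resI (p : Params T) (t : Fin T) : Measurable (p.resI t) := by
  unfold Params.resI
  fun_prop

lemma Params.measurable_resS (p : Params T) (t : Fin T) (κ : ℝ) : Measurable (p.resS t κ) := by
  have := p.measurable_resI t
  unfold Params.resS
  fun_prop

/-- Incomes and logarithms of the latent variables. -/
def Primitives.incLatent (L : Primitives T Ω) (ω : Ω) : (Fin T → ℝ) × (LatIdx T → ℝ) :=
  (L.incVec ω, fun i => L.logLatent i ω)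

lemma Baseline.measurable_incLatent (h : Baseline P L p) : Measurable L.incLatent :=
  h.meas_incVec.prodMk (measurable_pi_lambda _ h.measurable_logLatent)

lemma Baseline.resI_ae_eq (h : Baseline P L p) (t : Fin T) :
    (fun ω => p.resI t (L.incLatent ω)) =ᵐ[P] L.etaI t := by
  filter_upwards [h.investment t] with ω hω
  change L.logInv t ω - (p.beta0 t + p.beta1 t * L.logSkill t.castSucc ω
    + p.beta2 t * L.logInc t ω) = _
  linear_combination hω

lemma Baseline.resS_ae_eq (h : Baseline P L p) (t : Fin T) (κ : ℝ) :
    (fun ω => p.resS t κ (L.incLatent ω)) =ᵐ[P] fun ω => L.etaS t ω - κ * L.etaI t ω := by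
  filter_upwards [h.production t, h.resI_ae_eq t] with ω hω hI
  change L.logSkill t.succ ω - (p.a t + p.gam1 t * L.logSkill t.castSucc ω
    + p.gam2 t * L.logInv t ω + p.gam3 t * L.logSkill t.castSucc ω * L.logInv t ω)
    - κ * p.resI t (L.incLatent ω) = _
  rw [hI]
  linear_combination hω

lemma Baseline.integrable_resI (h : Baseline P L p) (t : Fin T) :
    Integrable (fun ω => p.resI t (L.incLatent ω)) P :=
  ((h.moment_etaI t).integrable one_le_two).congr (h.resI_ae_eq t).symm

lemma Baseline.integrable_resS (h : Baseline P L p) (t : Fin T) (κ : ℝ) :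
    Integrable (fun ω => p.resS t κ (L.incLatent ω)) P :=
  (((h.moment_etaS t).integrable one_le_two).sub
    (((h.moment_etaI t).integrable one_le_two).const_mul κ)).congr (h.resS_ae_eq t κ).symm

lemma Baseline.setIntegral_resI (h : Baseline P L p) (t : Fin T) {A : Set (ℝ × ℝ)}
    (hA : MeasurableSet A) :
    ∫ ω in {ω | (L.logSkill t.castSucc ω, L.inc t ω) ∈ A}, p.resI t (L.incLatent ω) ∂P = 0 := by
  have m2 : Measurable fun ω => (L.skill t.castSucc ω, L.inc t ω) :=
    (h.meas_skill _).prodMk (h.meas_inc t)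
  have hφ : Measurable fun z : ℝ × ℝ => (Real.log z.1, z.2) := by fun_prop
  have hS : MeasurableSet[MeasurableSpace.comap (fun ω => (L.skill t.castSucc ω, L.inc t ω))
      inferInstance] {ω | (L.logSkill t.castSucc ω, L.inc t ω) ∈ A} := ⟨_, hφ hA, rfl⟩
  have := setIntegral_sub_eq_zero_of_condExp m2.comap_le
    ((h.moment_etaI t).integrable one_le_two) (integrable_zero _ _ _) (h.etaI_mean t) hS
  rw [← this]
  refine setIntegral_congr_ae (m2.comap_le _ hS) ?_
  filter_upwards [h.resI_ae_eq t] with ω hω _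
  rw [hω, Pi.zero_apply, sub_zero]

/-- The control condition conditions on the investment shock, which is not among the identified
variables. Given skills and income, the investment equation makes log investment a translate of the
shock, so events in the identified regressors agree almost surely with events of the conditioning
σ-algebra. -/
lemma Baseline.setIntegral_resS (h : Baseline P L p) (t : Fin T) {κ : ℝ}
    (hκ : P[L.etaS t | MeasurableSpace.comap
      (fun ω => (L.skill t.castSucc ω, L.etaI t ω, L.inc t ω)) inferInstance]
        =ᵐ[P] fun ω => κ * L.etaI t ω) {A : Set (ℝ × ℝ × ℝ)} (hA : MeasurableSet A) :
    ∫ ω in {ω | (L.logSkill t.castSucc ω, L.logInv t ω, L.inc t ω) ∈ A},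
      p.resS t κ (L.incLatent ω) ∂P = 0 := by
  have m3 : Measurable fun ω => (L.skill t.castSucc ω, L.etaI t ω, L.inc t ω) :=
    (h.meas_skill _).prodMk ((h.meas_etaI t).prodMk (h.meas_inc t))
  have hφ : Measurable fun z : ℝ × ℝ × ℝ => (Real.log z.1, p.beta0 t + p.beta1 t * Real.log z.1
    + p.beta2 t * Real.log z.2.2 + z.2.1, z.2.2) := by fun_prop
  let S : Set Ω := {ω | (L.logSkill t.castSucc ω, p.beta0 t + p.beta1 t * L.logSkill t.castSucc ω
    + p.beta2 t * L.logInc t ω + L.etaI t ω, L.inc t ω) ∈ A}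
  have hS : MeasurableSet[MeasurableSpace.comap
      (fun ω => (L.skill t.castSucc ω, L.etaI t ω, L.inc t ω)) inferInstance] S :=
    ⟨_, hφ hA, rfl⟩
  have hSS : ({ω | (L.logSkill t.castSucc ω, L.logInv t ω, L.inc t ω) ∈ A} : Set Ω) =ᵐ[P] S := by
    filter_upwards [h.investment t] with ω hω
    change ((L.logSkill t.castSucc ω, L.logInv t ω, L.inc t ω) ∈ A) = (_ ∈ A)
    rw [hω]
  rw [setIntegral_congr_set hSS]
  have := setIntegral_sub_eq_zero_of_condExp m3.comap_le
    ((h.moment_etaS t).integrable one_le_two)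
    (((h.moment_etaI t).integrable one_le_two).const_mul κ) hκ hS
  rw [← this]
  exact setIntegral_congr_ae (m3.comap_le _ hS) ((h.resS_ae_eq t κ).mono fun ω hω _ => hω)

variable {Ω' : Type} [MeasurableSpace Ω'] [StandardBorelSpace Ω'] {P' : Measure Ω'}
  [IsProbabilityMeasure P'] {L' : Primitives T Ω'} {p' : Params T}

lemma Baseline.investment_eq (h : Baseline P L p) (h' : Baseline P' L' p')
    (hlaw : P.map L.incLatent = P'.map L'.incLatent) (t : Fin T) :
    p.beta0 t = p'.beta0 t ∧ p.beta1 t = p'.beta1 t ∧ p.beta2 t = p'.beta2 t := by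
  have key := ae_eq_zero_of_residuals h.measurable_incLatent h'.measurable_incLatent hlaw
    (q := p.resI t) (q' := p'.resI t) (r := fun z => (z.2 (Sum.inl t.castSucc), z.1 t))
    (d := fun z => (p'.beta0 t - p.beta0 t) + (p'.beta1 t - p.beta1 t) * z.1
      + (p'.beta2 t - p.beta2 t) * Real.log z.2)
    (p.measurable_resI t) (p'.measurable_resI t) (by fun_prop) (by fun_prop)
    (h.integrable_resI t) (h'.integrable_resI t)
    (fun z => by simp only [Params.resI]; ring) (fun A hA => h.setIntegral_resI t hA)
    (fun A hA => h'.setIntegral_resI t hA)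
  obtain ⟨c0, c1, -, -, c4⟩ := h.log_coeff_eq_zero t (b₀ := p'.beta0 t - p.beta0 t)
    (b₁ := p'.beta1 t - p.beta1 t) (b₂ := 0) (b₃ := 0) (b₄ := p'.beta2 t - p.beta2 t) (by
      filter_upwards [key] with ω hω
      rw [zero_mul, zero_mul, zero_mul, add_zero, add_zero]
      exact hω)
  exact ⟨(sub_eq_zero.1 c0).symm, (sub_eq_zero.1 c1).symm, (sub_eq_zero.1 c4).symm⟩

/-- The two models may have different control coefficients. Since the investment equation is already
identified, the difference of the residuals is a trans-log polynomial plus `κ' - κ` times the common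
investment residual. Its log income coefficient is `-(κ' - κ) * β₂`, so relevance forces `κ' = κ`,
and the remaining coefficients then agree. -/
lemma Baseline.production_eq (h : Baseline P L p) (h' : Baseline P' L' p')
    (hlaw : P.map L.incLatent = P'.map L'.incLatent) (t : Fin T) :
    p.a t = p'.a t ∧ p.gam1 t = p'.gam1 t ∧ p.gam2 t = p'.gam2 t ∧ p.gam3 t = p'.gam3 t := by
  obtain ⟨κ, hκ⟩ := h.control t
  obtain ⟨κ', hκ'⟩ := h'.control t
  obtain ⟨e0, e1, e2⟩ := h.investment_eq h' hlaw t
  have key := ae_eq_zero_of_residuals h.measurable_incLatent h'.measurable_incLatent hlaw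
    (q := p.resS t κ) (q' := p'.resS t κ')
    (r := fun z => (z.2 (Sum.inl t.castSucc), z.2 (Sum.inr t), z.1 t))
    (d := fun z => (p'.a t - p.a t - (κ' - κ) * p.beta0 t)
      + (p'.gam1 t - p.gam1 t - (κ' - κ) * p.beta1 t) * z.1
      + (p'.gam2 t - p.gam2 t + (κ' - κ)) * z.2.1 + (p'.gam3 t - p.gam3 t) * z.1 * z.2.1
      + (-(κ' - κ) * p.beta2 t) * Real.log z.2.2)
    (p.measurable_resS t κ) (p'.measurable_resS t κ') (by fun_prop) (by fun_prop)
    (h.integrable_resS t κ) (h'.integrable_resS t κ')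
    (fun z => by simp only [Params.resS, Params.resI, e0, e1, e2]; ring)
    (fun A hA => h.setIntegral_resS t hκ hA) (fun A hA => h'.setIntegral_resS t hκ' hA)
  obtain ⟨c0, c1, c2, c3, c4⟩ := h.log_coeff_eq_zero t key
  have k0 : κ' - κ = 0 :=
    neg_eq_zero.1 ((mul_eq_zero.1 c4).resolve_right (h.relevance t))
  rw [k0] at c0 c1 c2
  exact ⟨by linarith, by linarith, by linarith, by linarith⟩

/-- Parameters of normalized models that generate the same law of the observed variables agree. -/
theorem Baseline.params_eq (h : Baseline P L p) (h' : Baseline P' L' p') (hp : p.IsNormalized)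
    (hp' : p'.IsNormalized) (hlaw : obsLaw P L p = obsLaw P' L' p') : p = p' := by
  have : Nonempty Ω := P.nonempty_of_neZero
  have : Nonempty Ω' := P'.nonempty_of_neZero
  have hobs := congrArg (Measure.map obsCoord) hlaw
  rw [h.map_obsCoord_obsLaw, h'.map_obsCoord_obsLaw] at hobs
  have hM := h.measurement_eq h' hp hp' hobs
  have hlat : P.map L.incLatent = P'.map L'.incLatent := h.map_logLatent_eq h' hp hp' hobs
  have hI := h.investment_eq h' hlat
  have hS := h.production_eq h' hlat
  ext
  · exact (hM (Sum.inl (_, _))).2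
  · exact (hM (Sum.inl (_, _))).1
  · exact (hM (Sum.inr (Sum.inl (_, _)))).2
  · exact (hM (Sum.inr (Sum.inl (_, _)))).1
  · exact (hM (Sum.inr (Sum.inr ()))).2
  · exact (hM (Sum.inr (Sum.inr ()))).1
  · exact (hI _).1
  · exact (hI _).2.1
  · exact (hI _).2.2
  · exact (hS _).1
  · exact (hS _).2.1
  · exact (hS _).2.2.1
  · exact (hS _).2.2.2

/-- Rescaling is idempotent, so each model can be reparametrized to its own rescaled parameters.
These are normalized, and `Baseline.params_eq` equates them; the reverse inclusion keeps the sample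
space and changes scales. -/
theorem Baseline.identifiedSet_eq (h : Baseline P L p) :
    identifiedSet (obsLaw P L p) = {q | q.NonzeroLoadings ∧ q.tilde = p.tilde} := by
  ext q
  constructor
  · rintro ⟨Ω', _, _, P', _, L', h', hlaw⟩
    have hp := h.loadings
    have hq := h'.loadings
    have np := hp.isNormalized_tilde
    have nq := hq.isNormalized_tilde
    refine ⟨hq, (h'.reparam hq.tilde nq.tilde_eq).params_eq (h.reparam hp.tilde np.tilde_eq)
      nq np ?_⟩
    rw [obsLaw_reparam L' P' hq hq.tilde nq.tilde_eq, obsLaw_reparam L P hp hp.tilde np.tilde_eq,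
      hlaw]
  · rintro ⟨hq, hqp⟩
    exact ⟨Ω, _, inferInstance, P, inferInstance, L.reparam p q, h.reparam hq hqp,
      obsLaw_reparam L P h.loadings hq hqp⟩

end Equations

end SkillFormation

end

theorem theorem1 {T : ℕ} {Ω : Type} [MeasurableSpace Ω] [StandardBorelSpace Ω]
    (P : MeasureTheory.Measure Ω) [MeasureTheory.IsProbabilityMeasure P]
    (L : SkillFormation.Primitives T Ω) (p₀ : SkillFormation.Params T)
    (h : SkillFormation.Baseline P L p₀) :
    SkillFormation.identifiedSet (SkillFormation.obsLaw P L p₀) =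
        {p | p.NonzeroLoadings ∧ p.tilde = p₀.tilde} ∧
      ∀ (muS lamS : Fin (T + 1) → ℝ) (muI lamI : Fin T → ℝ),
        (∀ t, lamS t ≠ 0) → (∀ t, lamI t ≠ 0) →
        ∃ p : SkillFormation.Params T,
          {q | q ∈ SkillFormation.identifiedSet (SkillFormation.obsLaw P L p₀) ∧
              (∀ t, q.muS t 0 = muS t) ∧ (∀ t, q.lamS t 0 = lamS t) ∧
              (∀ t, q.muI t 0 = muI t) ∧ (∀ t, q.lamI t 0 = lamI t)} = {p} := by
  refine ⟨h.identifiedSet_eq, fun muS lamS muI lamI hS hI => ?_⟩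
  have hp := h.loadings
  have np := hp.isNormalized_tilde
  -- Rescaled parameters together with the intercepts and loadings of the first measures are
  -- complete coordinates; `rebase` reads a vector back from them, which gives existence and
  -- uniqueness.
  refine ⟨p₀.tilde.rebase muS lamS muI lamI, ?_⟩
  rw [h.identifiedSet_eq]
  refine Set.eq_singleton_iff_unique_mem.2 ⟨⟨⟨hp.tilde.rebase hS hI, np.tilde_rebase hS hI⟩,
    fun t => ?_, fun t => ?_, fun t => ?_, fun t => ?_⟩, ?_⟩
  · simp [SkillFormation.Params.rebase, np.muS, np.lamS]
  · simp [SkillFormation.Params.rebase, np.lamS]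
  · simp [SkillFormation.Params.rebase, np.muI, np.lamI]
  · simp [SkillFormation.Params.rebase, np.lamI]
  · rintro q ⟨⟨hq, hqp⟩, h1, h2, h3, h4⟩
    rw [← SkillFormation.Params.rebase_tilde hq, hqp, funext h1, funext h2, funext h3, funext h4]
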